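/- Let $p$ be a prime and let all rings be Noetherian $F$-finite rings of characteristic $p$. A Cartier $R$-algebra is an $\mathbb N$-graded ring $\mathcal C=\bigoplus_e \mathcal C_e$ with $\mathcal C_0=R$ and $r\kappa=\kappa r^{p^e}$ for all $r\in R$, $\kappa\in\mathcal C_e$; a Cartier $\mathcal C$-module is a left $\mathcal C$-module that is finite over $R$. Put $\mathcal C_+=\bigoplus_{e\ge 1}\mathcal C_e$; a map of left $\mathcal C$-modules is a nil-isomorphism if its kernel and cokernel are annihilated by a power of $\mathcal C_+$. The test module $\tau(M,\mathcal C)$ is the smallest $\mathcal C$-submodule $N\subseteq M$ such that $H^0_\eta(N_\eta)\to H^0_\eta(M_\eta)$ is a nil-isomorphism of $\mathcal C_\eta$-modules for every $\eta\in\operatorname{Ass}M$, where $\mathcal C_\eta=\mathcal C\otimes_R R_\eta$; and $(M,\mathcal C)$ is $F$-regular if $\tau(M,\mathcal C)=M$. Let $f\colon\operatorname{Spec}S\to\operatorname{Spec}R$ be a finite cover, i.e. a finite dominant morphism. Let $f^*\mathcal C=\mathcal C\otimes_R S$ be the Cartier $S$-algebra with multiplication $(\kappa\otimes s)(\kappa'\otimes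 s')=\kappa\kappa'\otimes s^{p^{e}}s'$ for $\kappa'\in\mathcal C_{e}$. For a Cartier $\mathcal C$-module $M$ let $f^!M=\operatorname{Hom}_R(S,M)$ be the Cartier $f^*\mathcal C$-module with $\big((\kappa\otimes s')\cdot\mu\big)(s)=\kappa\cdot\mu(s's^{p^e})$ for $\kappa\in\mathcal C_e$, and let $\operatorname{Tr}_M\colon f_*f^!M\to M$, $\mu\mapsto\mu(1)$. Theorem. For every finite cover $f\colon\operatorname{Spec}S\to\operatorname{Spec}R$, every Cartier $R$-algebra $\mathcal C$ and every Cartier $\mathcal C$-module $M$, the test modules $\tau(M,\mathcal C)$ and $\tau(f^!M,f^*\mathcal C)$ exist and $$\operatorname{Tr}_M\big(f_*\tau(f^!M,f^*\mathcal C)\big)=\tau(M,\mathcal C).$$ In particular, $\operatorname{Tr}_M$ is surjective if $(M,\mathcal C)$ is $F$-regular. Conversely, if $\operatorname{Tr}_M$ is surjective and $(f^!M,f^*\mathcal C)$ is $F$-regular, then $(M,\mathcal C)$ is $F$-regular. -/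

import Mathlib

open scoped TensorProduct

universe u v w x

set_option linter.unusedSectionVars false

noncomputable section

theorem tensorAddHom_ext {R : Type*} [CommRing R] {M N P : Type*} [AddCommGroup M] [Module R M]
    [AddCommGroup N] [Module R N] [AddCommGroup P] {f g : M ⊗[R] N →+ P}
    (h : ∀ m n, f (m ⊗ₜ n) = g (m ⊗ₜ n)) : f = g := by
  ext y
  induction y with
  | zero => simp
  | add y z hy hz => rw [map_add, map_add, hy, hz]
  | tmul m n => exact h m n

/-- A Cartier algebra over a ring `R` (of characteristic `p`): an `ℕ`-graded ring
`C = ⨁ₑ Cₑ`, given by its homogeneous pieces `gr e = Cₑ` and the multiplication maps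
`C_d × C_e → C_{d+e}`, with an identification `R ≃ C₀`, and such that
`r · κ = κ · r ^ (p ^ e)` for all `r : R` and `κ : Cₑ`.
The scalar multiplication `r • κ` on `gr e` is the *right* `R`-module structure `κ · r`
(`R` is commutative); the left one is multiplication by `ofR r` on the left.
The unit of the ring is `ofR 1`; it is two-sided by `mul_ofR` and `ofR_mul`. -/
structure CartierAlgebra (p : ℕ) (R : Type u) [CommRing R] where
  /-- the homogeneous piece of degree `e` -/
  gr : ℕ → Type v
  [addCommGroup : ∀ e, AddCommGroup (gr e)]
  /-- the right `R`-module structure of the homogeneous pieces -/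
  [module : ∀ e, Module R (gr e)]
  /-- multiplication of homogeneous elements -/
  mul : ∀ {d e n : ℕ}, d + e = n → gr d →+ gr e →+ gr n
  mul_assoc : ∀ {a b c ab bc n : ℕ} (hab : a + b = ab) (hbc : b + c = bc)
    (h₁ : ab + c = n) (h₂ : a + bc = n) (α : gr a) (β : gr b) (γ : gr c),
    mul h₁ (mul hab α β) γ = mul h₂ α (mul hbc β γ)
  /-- the identification of `R` with the piece of degree `0` -/
  ofR : R ≃ₗ[R] gr 0
  mul_ofR : ∀ {e : ℕ} (κ : gr e) (r : R), mul (Nat.add_zero e) κ (ofR r) = r • κ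
  ofR_mul : ∀ {e : ℕ} (r : R) (κ : gr e), mul (Nat.zero_add e) (ofR r) κ = r ^ p ^ e • κ

attribute [instance] CartierAlgebra.addCommGroup CartierAlgebra.module

namespace CartierAlgebra

variable {p : ℕ} {R : Type u} [CommRing R] (C : CartierAlgebra.{u, v} p R)

theorem mul_smul {d e n : ℕ} (h : d + e = n) (κ : C.gr d) (r : R) (lam : C.gr e) :
    C.mul h κ (r • lam) = r • C.mul h κ lam := by
  rw [← C.mul_ofR lam r, ← C.mul_ofR (C.mul h κ lam) r]
  exact (C.mul_assoc h (Nat.add_zero e) (Nat.add_zero n) h κ lam (C.ofR r)).symm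

theorem smul_mul {d e n : ℕ} (h : d + e = n) (r : R) (κ : C.gr d) (lam : C.gr e) :
    C.mul h (r • κ) lam = r ^ p ^ e • C.mul h κ lam := by
  rw [← C.mul_ofR κ r, C.mul_assoc (Nat.add_zero d) (Nat.zero_add e) h h, C.ofR_mul, C.mul_smul]

end CartierAlgebra

section Frobenius

variable (p : ℕ) [Fact p.Prime] (R : Type u) [CommRing R] [CharP R p]
  (S : Type w) [CommRing S] [Algebra R S]

/-- The `e`-th iterate `s ↦ s ^ (p ^ e)` of Frobenius on an algebra `S` over a ring `R` of
characteristic `p`. -/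
def frobPow (e : ℕ) : S →+* S where
  toFun s := s ^ p ^ e
  map_one' := one_pow _
  map_mul' a b := mul_pow a b _
  map_zero' := zero_pow (pow_ne_zero _ (Fact.out : p.Prime).ne_zero)
  map_add' a b := by
    obtain ⟨r, hr⟩ := exists_add_pow_prime_pow_eq (Fact.out : p.Prime) a b e
    have h0 : (p : S) = 0 := by
      rw [← map_natCast (algebraMap R S) p, CharP.cast_eq_zero, map_zero]
    rw [hr, h0]
    ring

@[simp]
theorem frobPow_apply (e : ℕ) (s : S) : frobPow p R S e s = s ^ p ^ e := rfl

end Frobenius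

namespace CartierAlgebra

variable {p : ℕ} [Fact p.Prime] {R : Type u} [CommRing R] [CharP R p]
  (C : CartierAlgebra.{u, v} p R) (S : Type w) [CommRing S] [Algebra R S]

/-- `κ' ↦ κ · κ'` as a linear map for the right `R`-module structures. -/
def mulLin {d e n : ℕ} (h : d + e = n) (κ : C.gr d) : C.gr e →ₗ[R] C.gr n where
  toFun lam := C.mul h κ lam
  map_add' := map_add _
  map_smul' r lam := C.mul_smul h κ r lam

/-- Multiplication on `S ⊗ C`: `(s ⊗ κ) · (s' ⊗ κ') = s ^ (p ^ e) s' ⊗ κ κ'`, `e = deg κ'`. -/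
def pullbackMul {d e n : ℕ} (h : d + e = n) :
    (S ⊗[R] C.gr d) →+ (S ⊗[R] C.gr e) →+ (S ⊗[R] C.gr n) :=
  TensorProduct.liftAddHom
    (AddMonoidHom.mk'
      (fun s => AddMonoidHom.mk'
        (fun κ => (TensorProduct.map (LinearMap.mulLeft R (frobPow p R S e s))
          (C.mulLin h κ)).toAddMonoidHom)
        (fun κ κ' => by
          refine tensorAddHom_ext fun t lam => ?_
          simp [mulLin, TensorProduct.tmul_add]))
      (fun s s' => by
        ext κ : 1
        refine tensorAddHom_ext fun t lam => ?_
        simp only [map_add]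
        simp [add_mul, TensorProduct.add_tmul]))
    (fun r s κ => by
      refine tensorAddHom_ext fun t lam => ?_
      change ((r • s) ^ p ^ e * t) ⊗ₜ[R] C.mul h κ lam = (s ^ p ^ e * t) ⊗ₜ[R] C.mul h (r • κ) lam
      rw [C.smul_mul, smul_pow, smul_mul_assoc, TensorProduct.smul_tmul])

@[simp]
theorem pullbackMul_tmul {d e n : ℕ} (h : d + e = n) (s t : S) (κ : C.gr d) (lam : C.gr e) :
    C.pullbackMul S h (s ⊗ₜ κ) (t ⊗ₜ lam) = (s ^ p ^ e * t) ⊗ₜ C.mul h κ lam := rfl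

/-- The pullback `f^* C` of a Cartier `R`-algebra along `R → S`: the graded right `S`-module
`C ⊗_R S` (written `S ⊗_R C`, for the right `R`-module structure of `C`), with the multiplication
`(κ ⊗ s) · (κ' ⊗ s') = κ κ' ⊗ s ^ (p ^ e) s'`, `e = deg κ'`. -/
def pullback : CartierAlgebra.{w, max v w} p S where
  gr e := S ⊗[R] C.gr e
  mul h := C.pullbackMul S h
  mul_assoc {a b c ab bc n} hab hbc h₁ h₂ α β γ := by
    induction α with
    | zero => simp
    | add x y hx hy => simp [hx, hy]
    | tmul s κ =>
      induction β with
      | zero => simp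
      | add x y hx hy => simp [hx, hy]
      | tmul t lam =>
        induction γ with
        | zero => simp
        | add x y hx hy => simp only [map_add, hx, hy]
        | tmul r ν =>
          simp only [pullbackMul_tmul, C.mul_assoc hab hbc h₁ h₂]
          congr 1
          rw [mul_pow, ← pow_mul, ← pow_add, hbc, _root_.mul_assoc]
  ofR := (TensorProduct.AlgebraTensorModule.rid R S S).symm.trans
    (TensorProduct.AlgebraTensorModule.congr (LinearEquiv.refl S S) C.ofR)
  mul_ofR {e} κ r := by
    induction κ with
    | zero => simp
    | add x y hx hy => simp only [map_add, AddMonoidHom.add_apply, smul_add, hx, hy]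
    | tmul s κ =>
      simp [C.mul_ofR, TensorProduct.smul_tmul', mul_comm]
  ofR_mul {e} r κ := by
    induction κ with
    | zero => simp
    | add x y hx hy => simp only [map_add, smul_add, hx, hy]
    | tmul s κ =>
      simp [C.ofR_mul, TensorProduct.smul_tmul']

@[simp]
theorem pullback_mul_tmul {d e n : ℕ} (h : d + e = n) (s t : S) (κ : C.gr d) (lam : C.gr e) :
    (C.pullback S).mul h (s ⊗ₜ[R] κ : S ⊗[R] C.gr d) (t ⊗ₜ[R] lam : S ⊗[R] C.gr e) =
      ((s ^ p ^ e * t) ⊗ₜ[R] C.mul h κ lam : S ⊗[R] C.gr n) := rfl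

theorem pullback_ofR (s : S) :
    (C.pullback S).ofR s = (s ⊗ₜ[R] C.ofR 1 : S ⊗[R] C.gr 0) := rfl

end CartierAlgebra

/-- A left module structure over the Cartier algebra `C` on an `R`-module `M`, extending its
`R`-module structure. A Cartier module is a finite `R`-module with such a structure. -/
structure CartierAction {p : ℕ} {R : Type u} [CommRing R] (C : CartierAlgebra.{u, v} p R)
    (M : Type x) [AddCommGroup M] [Module R M] where
  /-- the action of homogeneous elements -/
  act : ∀ {e : ℕ}, C.gr e →+ M →+ M
  act_ofR : ∀ (r : R) (m : M), act (C.ofR r) m = r • m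
  act_mul : ∀ {d e n : ℕ} (h : d + e = n) (κ : C.gr d) (lam : C.gr e) (m : M),
    act (C.mul h κ lam) m = act κ (act lam m)

namespace CartierAction

variable {p : ℕ} {R : Type u} [CommRing R] {C : CartierAlgebra.{u, v} p R}
  {M : Type x} [AddCommGroup M] [Module R M] (A : CartierAction C M)

theorem act_smul_left {e : ℕ} (r : R) (κ : C.gr e) (m : M) :
    A.act (r • κ) m = A.act κ (r • m) := by
  rw [← C.mul_ofR, A.act_mul, A.act_ofR]

theorem act_pow_smul {e : ℕ} (r : R) (κ : C.gr e) (m : M) :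
    A.act κ (r ^ p ^ e • m) = r • A.act κ m := by
  rw [← A.act_smul_left, ← C.ofR_mul, A.act_mul, A.act_ofR]

/-- `N` is a Cartier submodule, i.e. stable under `C`. -/
def IsCartierSubmodule (N : Submodule R M) : Prop :=
  ∀ (e : ℕ) (κ : C.gr e), ∀ m ∈ N, A.act κ m ∈ N

/-- `C₊ N`, where `C₊ = ⨁_{e ≥ 1} Cₑ`. -/
def plus (N : Submodule R M) : Submodule R M :=
  Submodule.span R {y | ∃ e : ℕ, 1 ≤ e ∧ ∃ κ : C.gr e, ∃ m ∈ N, A.act κ m = y}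

/-- The inclusion `N ⊆ N'` of submodules is a nil-isomorphism: the kernel is zero, and
the cokernel `N' / N` is annihilated by some power of `C₊`. -/
def IsNilIsoInclusion (N N' : Submodule R M) : Prop :=
  N ≤ N' ∧ ∃ n : ℕ, A.plus^[n] N' ≤ N

end CartierAction

/-- `H⁰_I(N)`: the elements of the submodule `N` that are annihilated by a power of `I`. -/
def localCohomologyZero {R : Type u} [CommRing R] {M : Type x} [AddCommGroup M] [Module R M]
    (I : Ideal R) (N : Submodule R M) : Submodule R M where
  carrier := {m | m ∈ N ∧ ∃ k : ℕ, ∀ a ∈ I ^ k, a • m = 0}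
  zero_mem' := ⟨N.zero_mem, 0, fun a _ => smul_zero a⟩
  add_mem' := by
    rintro m m' ⟨hm, k, hk⟩ ⟨hm', k', hk'⟩
    refine ⟨N.add_mem hm hm', k + k', fun a ha => ?_⟩
    rw [smul_add, hk a (Ideal.pow_le_pow_right (Nat.le_add_right k k') ha),
      hk' a (Ideal.pow_le_pow_right (Nat.le_add_left k' k) ha), add_zero]
  smul_mem' := by
    rintro r m ⟨hm, k, hk⟩
    exact ⟨N.smul_mem r hm, k, fun a ha => by rw [smul_comm, hk a ha, smul_zero]⟩

namespace CartierAction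

section Localization

variable {p : ℕ} [Fact p.Prime] {R : Type u} [CommRing R] [CharP R p]
  {C : CartierAlgebra.{u, v} p R} {M : Type x} [AddCommGroup M] [Module R M]
  (A : CartierAction C M) (W : Submonoid R)

/-- The action of `κ : Cₑ` on a localization: `m / t ↦ κ (t ^ (p ^ e - 1) m) / t`. -/
def locFun {e : ℕ} (κ : C.gr e) (y : LocalizedModule W M) : LocalizedModule W M :=
  y.liftOn (fun mt => LocalizedModule.mk (A.act κ ((mt.2 : R) ^ (p ^ e - 1) • mt.1)) mt.2)
    (by
      have hq : p ^ e ≠ 0 := pow_ne_zero _ (Fact.out : p.Prime).ne_zero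
      rintro ⟨m, t⟩ ⟨m', t'⟩ ⟨c, hc⟩
      refine LocalizedModule.mk_eq.mpr ⟨c, ?_⟩
      simp only [Submonoid.smul_def, ← A.act_pow_smul] at hc ⊢
      congr 1
      obtain ⟨q, hq'⟩ := Nat.exists_eq_succ_of_ne_zero hq
      rw [hq', Nat.succ_sub_one, Nat.succ_eq_add_one]
      have := congrArg (fun z => ((c : R) ^ q * (t : R) ^ q * (t' : R) ^ q) • z) hc
      simp only [smul_smul] at this ⊢
      convert this using 2 <;> ring_nf)

theorem locFun_mk {e : ℕ} (κ : C.gr e) (m : M) (t : W) :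
    A.locFun W κ (LocalizedModule.mk m t) =
      LocalizedModule.mk (A.act κ ((t : R) ^ (p ^ e - 1) • m)) t := rfl

theorem locFun_mk_pow {e : ℕ} (κ : C.gr e) (m : M) (t : W) :
    A.locFun W κ (LocalizedModule.mk m (t ^ p ^ e)) = LocalizedModule.mk (A.act κ m) t := by
  have hq : p ^ e ≠ 0 := pow_ne_zero _ (Fact.out : p.Prime).ne_zero
  obtain ⟨q, hq'⟩ := Nat.exists_eq_succ_of_ne_zero hq
  rw [locFun_mk]
  refine LocalizedModule.mk_eq.mpr ⟨1, ?_⟩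
  simp only [Submonoid.smul_def, ← A.act_pow_smul, smul_smul]
  congr 2
  rw [hq', Nat.succ_sub_one, Nat.succ_eq_add_one]
  push_cast
  ring_nf

theorem exists_mk_pow (e : ℕ) (y : LocalizedModule W M) :
    ∃ (m : M) (t : W), y = LocalizedModule.mk m (t ^ p ^ e) := by
  have hq : p ^ e ≠ 0 := pow_ne_zero _ (Fact.out : p.Prime).ne_zero
  obtain ⟨q, hq'⟩ := Nat.exists_eq_succ_of_ne_zero hq
  induction y using LocalizedModule.induction_on with
  | h m t =>
    refine ⟨t ^ q • m, t, ?_⟩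
    rw [hq', pow_succ, LocalizedModule.mk_cancel_common_left]

theorem exists_mk_pow₂ (e : ℕ) (y z : LocalizedModule W M) :
    ∃ (m n : M) (t : W), y = LocalizedModule.mk m (t ^ p ^ e) ∧
      z = LocalizedModule.mk n (t ^ p ^ e) := by
  obtain ⟨m, s, rfl⟩ := exists_mk_pow (p := p) W e y
  obtain ⟨n, t, rfl⟩ := exists_mk_pow (p := p) W e z
  refine ⟨t ^ p ^ e • m, s ^ p ^ e • n, s * t, ?_, ?_⟩
  · rw [mul_pow, LocalizedModule.mk_cancel_common_right]
  · rw [mul_pow, LocalizedModule.mk_cancel_common_left]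

theorem mk_add_mk_same (m n : M) (t : W) :
    LocalizedModule.mk m t + LocalizedModule.mk n t = LocalizedModule.mk (m + n) t := by
  rw [LocalizedModule.mk_add_mk, ← smul_add, LocalizedModule.mk_cancel_common_left]

theorem locFun_add {e : ℕ} (κ : C.gr e) (y z : LocalizedModule W M) :
    A.locFun W κ (y + z) = A.locFun W κ y + A.locFun W κ z := by
  obtain ⟨m, n, t, rfl, rfl⟩ := exists_mk_pow₂ (p := p) W e y z
  rw [mk_add_mk_same, locFun_mk_pow, locFun_mk_pow, locFun_mk_pow, mk_add_mk_same, map_add]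

theorem locFun_pow_smul {e : ℕ} (κ : C.gr e) (a : Localization W) (y : LocalizedModule W M) :
    A.locFun W κ (a ^ p ^ e • y) = a • A.locFun W κ y := by
  obtain ⟨m, t, rfl⟩ := exists_mk_pow (p := p) W e y
  induction a using Localization.induction_on with
  | H rs =>
    obtain ⟨r, s⟩ := rs
    rw [Localization.mk_pow, LocalizedModule.mk_smul_mk, ← mul_pow, locFun_mk_pow, locFun_mk_pow,
      LocalizedModule.mk_smul_mk, A.act_pow_smul]

theorem locFun_add_left {e : ℕ} (κ κ' : C.gr e) (y : LocalizedModule W M) :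
    A.locFun W (κ + κ') y = A.locFun W κ y + A.locFun W κ' y := by
  obtain ⟨m, t, rfl⟩ := exists_mk_pow (p := p) W e y
  rw [locFun_mk_pow, locFun_mk_pow, locFun_mk_pow, mk_add_mk_same, map_add,
    AddMonoidHom.add_apply]

theorem locFun_smul_left {e : ℕ} (r : R) (κ : C.gr e) (y : LocalizedModule W M) :
    A.locFun W (r • κ) y = A.locFun W κ (r • y) := by
  obtain ⟨m, t, rfl⟩ := exists_mk_pow (p := p) W e y
  rw [LocalizedModule.smul'_mk, locFun_mk_pow, locFun_mk_pow, A.act_smul_left]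

theorem locFun_mul {d e n : ℕ} (h : d + e = n) (κ : C.gr d) (lam : C.gr e)
    (y : LocalizedModule W M) :
    A.locFun W (C.mul h κ lam) y = A.locFun W κ (A.locFun W lam y) := by
  obtain ⟨m, t, rfl⟩ := exists_mk_pow (p := p) W n y
  have hn : t ^ p ^ n = (t ^ p ^ d) ^ p ^ e := by rw [← h, pow_add, pow_mul]
  rw [locFun_mk_pow, hn, locFun_mk_pow, locFun_mk_pow, A.act_mul]

theorem locFun_one (y : LocalizedModule W M) : A.locFun W (C.ofR 1) y = y := by
  induction y using LocalizedModule.induction_on with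
  | h m t => simp [locFun_mk, A.act_ofR]

/-- The action `(κ ⊗ a) · y = κ (a y)` of `C ⊗_R W⁻¹R` on `W⁻¹M`. -/
def locAct {e : ℕ} :
    (Localization W ⊗[R] C.gr e) →+ LocalizedModule W M →+ LocalizedModule W M :=
  TensorProduct.liftAddHom
    (AddMonoidHom.mk'
      (fun a => AddMonoidHom.mk'
        (fun κ => AddMonoidHom.mk' (fun y => A.locFun W κ (a • y))
          (fun y z => by rw [smul_add, locFun_add]))
        (fun κ κ' => by ext y; exact A.locFun_add_left W κ κ' _))
      (fun a b => by
        ext κ y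
        change A.locFun W κ ((a + b) • y) = A.locFun W κ (a • y) + A.locFun W κ (b • y)
        rw [add_smul, locFun_add]))
    (fun r a κ => by
      ext y
      change A.locFun W κ ((r • a) • y) = A.locFun W (r • κ) (a • y)
      rw [locFun_smul_left, smul_assoc])

@[simp]
theorem locAct_tmul {e : ℕ} (a : Localization W) (κ : C.gr e) (y : LocalizedModule W M) :
    A.locAct W (a ⊗ₜ κ) y = A.locFun W κ (a • y) := rfl

theorem locAct_mul {d e n : ℕ} (h : d + e = n) (κ : Localization W ⊗[R] C.gr d)
    (lam : Localization W ⊗[R] C.gr e) (y : LocalizedModule W M) :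
    A.locAct W (C.pullbackMul (Localization W) h κ lam) y =
      A.locAct W κ (A.locAct W lam y) := by
  induction κ with
  | zero => simp
  | add κ κ' h₁ h₂ => simp only [map_add, AddMonoidHom.add_apply, h₁, h₂]
  | tmul a κ =>
    induction lam with
    | zero => simp only [map_zero, AddMonoidHom.zero_apply]
    | add lam lam' h₁ h₂ => simp only [map_add, AddMonoidHom.add_apply, h₁, h₂]
    | tmul b lam =>
      rw [CartierAlgebra.pullbackMul_tmul, locAct_tmul, locAct_tmul, locAct_tmul, locFun_mul,
        SemigroupAction.mul_smul, locFun_pow_smul]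

/-- The localization `W⁻¹M` is a module over `W⁻¹C = C ⊗_R W⁻¹R`, by
`(κ ⊗ a) · y = κ (a y)` and `κ (m / t) = κ (t ^ (p ^ e - 1) m) / t` for `κ : Cₑ`. -/
def localization : CartierAction (C.pullback (Localization W)) (LocalizedModule W M) where
  act := A.locAct W
  act_ofR a y := A.locFun_one W (a • y)
  act_mul h κ lam y := A.locAct_mul W h κ lam y

end Localization

section TestModule

variable {p : ℕ} [Fact p.Prime] {R : Type u} [CommRing R] [CharP R p]
  {C : CartierAlgebra.{u, v} p R} {M : Type x} [AddCommGroup M] [Module R M]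
  (A : CartierAction C M)

/-- The Cartier submodules `N` of `M` such that, for every associated prime `η` of `M`,
`H⁰_η(N_η) → H⁰_η(M_η)` is a nil-isomorphism of `C_η`-modules. -/
def testFamily : Set (Submodule R M) :=
  {N | A.IsCartierSubmodule N ∧ ∀ (η : Ideal R) [η.IsPrime], η ∈ associatedPrimes R M →
    (A.localization η.primeCompl).IsNilIsoInclusion
      (localCohomologyZero (η.map (algebraMap R (Localization.AtPrime η)))
        (N.localized η.primeCompl))
      (localCohomologyZero (η.map (algebraMap R (Localization.AtPrime η))) ⊤)}

/-- `T` is the test module of `(M, C)`: the smallest element of `testFamily`. -/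
def IsTestModule (T : Submodule R M) : Prop :=
  IsLeast A.testFamily T

/-- The test module `τ(M, C)`: the intersection of all elements of `testFamily`, which is
the smallest element whenever there is one. -/
def testModule : Submodule R M :=
  sInf A.testFamily

/-- `(M, C)` is `F`-regular: `τ(M, C)` is the whole of `M`. -/
def IsFRegular : Prop :=
  A.testModule = ⊤

end TestModule

end CartierAction

/-- `f^! M = Hom_R(S, M)`, as an `S`-module by `(s • μ)(t) = μ(s t)`. -/
def UpperShriek (R : Type u) (S : Type w) (M : Type x) [CommRing R] [CommRing S] [Algebra R S]
    [AddCommGroup M] [Module R M] : Type (max w x) :=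
  S →ₗ[R] M

namespace UpperShriek

variable {R : Type u} {S : Type w} {M : Type x} [CommRing R] [CommRing S] [Algebra R S]
  [AddCommGroup M] [Module R M]

instance : AddCommGroup (UpperShriek R S M) := inferInstanceAs (AddCommGroup (S →ₗ[R] M))

instance : Module R (UpperShriek R S M) := inferInstanceAs (Module R (S →ₗ[R] M))

instance : FunLike (UpperShriek R S M) S M := inferInstanceAs (FunLike (S →ₗ[R] M) S M)

instance : LinearMapClass (UpperShriek R S M) R S M :=
  inferInstanceAs (LinearMapClass (S →ₗ[R] M) R S M)

@[ext]
theorem ext {μ ν : UpperShriek R S M} (h : ∀ s, μ s = ν s) : μ = ν := DFunLike.ext _ _ h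

@[simp]
theorem add_apply (μ ν : UpperShriek R S M) (s : S) : (μ + ν) s = μ s + ν s := rfl

@[simp]
theorem zero_apply (s : S) : (0 : UpperShriek R S M) s = 0 := rfl

@[simp]
theorem base_smul_apply (r : R) (μ : UpperShriek R S M) (s : S) : (r • μ) s = r • μ s := rfl

instance : SMul S (UpperShriek R S M) where
  smul s μ := LinearMap.comp (μ : S →ₗ[R] M) (LinearMap.mulLeft R s)

@[simp]
theorem smul_apply (s : S) (μ : UpperShriek R S M) (t : S) : (s • μ) t = μ (s * t) := rfl

instance : Module S (UpperShriek R S M) where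
  one_smul μ := by ext; simp
  mul_smul s t μ := by ext r; simp only [smul_apply]; congr 1; ring
  smul_zero s := by ext; simp
  smul_add s μ ν := by ext; simp
  add_smul s t μ := by ext; simp [add_mul]
  zero_smul μ := by ext; simp

instance : IsScalarTower R S (UpperShriek R S M) where
  smul_assoc r s μ := by ext t; simp

variable (R S M) in
/-- The trace `Tr_M : f_* f^! M → M`, evaluation at `1`. -/
def trace : UpperShriek R S M →ₗ[R] M where
  toFun μ := μ 1
  map_add' _ _ := rfl
  map_smul' _ _ := rfl

end UpperShriek

namespace CartierAction

variable {p : ℕ} [Fact p.Prime] {R : Type u} [CommRing R] [CharP R p]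
  {C : CartierAlgebra.{u, v} p R} {M : Type x} [AddCommGroup M] [Module R M]
  (A : CartierAction C M) (S : Type w) [CommRing S] [Algebra R S]

/-- `κ ⊗ a` acting on `μ : f^! M`: the map `s ↦ κ · μ (a s ^ (p ^ e))`. -/
def shriekFun {e : ℕ} (a : S) (κ : C.gr e) (μ : UpperShriek R S M) : UpperShriek R S M :=
  { toFun := fun s => A.act κ (μ (a * s ^ p ^ e))
    map_add' := fun s t => by
      rw [← frobPow_apply p R S, ← frobPow_apply p R S, ← frobPow_apply p R S, map_add, mul_add,
        map_add, map_add]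
    map_smul' := fun r s => by
      rw [smul_pow, mul_smul_comm, map_smul, A.act_pow_smul, RingHom.id_apply] :
    S →ₗ[R] M }

@[simp]
theorem shriekFun_apply {e : ℕ} (a : S) (κ : C.gr e) (μ : UpperShriek R S M) (s : S) :
    A.shriekFun S a κ μ s = A.act κ (μ (a * s ^ p ^ e)) := rfl

/-- The action `((κ ⊗ a) · μ)(s) = κ · μ (a s ^ (p ^ e))` of `C ⊗_R S` on `f^! M`. -/
def shriekAct {e : ℕ} : (S ⊗[R] C.gr e) →+ UpperShriek R S M →+ UpperShriek R S M :=
  TensorProduct.liftAddHom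
    (AddMonoidHom.mk'
      (fun a => AddMonoidHom.mk'
        (fun κ => AddMonoidHom.mk' (fun μ => A.shriekFun S a κ μ)
          (fun μ ν => by ext s; simp))
        (fun κ κ' => by ext μ s; simp))
      (fun a b => by ext κ μ s; simp [add_mul]))
    (fun r a κ => by
      ext μ s
      simp [A.act_smul_left])

@[simp]
theorem shriekAct_tmul {e : ℕ} (a : S) (κ : C.gr e) (μ : UpperShriek R S M) :
    A.shriekAct S (a ⊗ₜ κ) μ = A.shriekFun S a κ μ := rfl

theorem shriekAct_mul {d e n : ℕ} (h : d + e = n) (κ : S ⊗[R] C.gr d) (lam : S ⊗[R] C.gr e)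
    (μ : UpperShriek R S M) :
    A.shriekAct S (C.pullbackMul S h κ lam) μ = A.shriekAct S κ (A.shriekAct S lam μ) := by
  induction κ with
  | zero => simp
  | add κ κ' h₁ h₂ => simp only [map_add, AddMonoidHom.add_apply, h₁, h₂]
  | tmul a κ =>
    induction lam with
    | zero => simp only [map_zero, AddMonoidHom.zero_apply]
    | add lam lam' h₁ h₂ => simp only [map_add, AddMonoidHom.add_apply, h₁, h₂]
    | tmul b lam =>
      ext s
      have hs : s ^ p ^ n = (s ^ p ^ d) ^ p ^ e := by rw [← h, pow_add, pow_mul]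
      simp only [CartierAlgebra.pullbackMul_tmul, shriekAct_tmul, shriekFun_apply, A.act_mul, hs]
      congr 3
      ring

/-- The `f^* C`-module structure of `f^! M`:
`((κ ⊗ a) · μ)(s) = κ · μ (a s ^ (p ^ e))` for `κ : Cₑ`. -/
def upperShriek : CartierAction (C.pullback S) (UpperShriek R S M) where
  act := A.shriekAct S
  act_ofR a μ := by
    change A.shriekFun S a (C.ofR 1) μ = a • μ
    ext s
    simp [A.act_ofR]
  act_mul h κ lam μ := A.shriekAct_mul S h κ lam μ

end CartierAction

end

/-! Write `M[η]` for the elements killed by `η`. An operator of degree `e` turns `a` into `a ^ (p ^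
e)` as `a` moves inside it, so high-degree operators map `H⁰_η` into `M[η]`. Hence the
nil-isomorphism condition at `η` says that `c · C₊ ^ n M[η] ⊆ N` for some `n` and some `c ∉ η`
(`isNilIsoInclusion_iff_isNilAt`), and no localization remains.

Existence: it suffices to find a least Cartier submodule satisfying the condition at each single
`η`; the sum of these is the test module. Since `M[η]` is `Hom_R(R/η, M)`, the problem moves to a
domain `D`. There the chain `C₊ ^ n E` is generically stationary, which gives a `Q` with `C₊ Q = Q`
generically. The point is an element `c ≠ 0` such that every Cartier submodule `N` generically
containing `Q` contains some `c ^ k Q` (`exists_pow_smul_mem_of_generic`). The power can then be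
made uniform: `c ^ 3 Q ⊆ N` (`pow_three_smul_mem`), and `C · c ^ 3 Q` is least.

No finite generation of `C` is assumed, so `c` comes from a dimension count. Over `K = Frac D`, let
`P_b ⊆ Hom(F^b_* K, E_K)` be spanned by the maps that operators of degree at least `b` induce. Then
`P_{b+1} ⊆ Hom_K(F_* K, P_b)`, and coinduction along Frobenius does not increase the dimension, so
equality holds for some `b` (`exists_eq_coind`). Thus for `φ ∈ P_b` and a coordinate function `π` of
`K` over `K ^ p`, the map `φ ∘ π` again comes from operators in `C`, with a denominator independent
of `N`. Consequently the ideal `J` of all `r` with `c ^ k r Q ⊆ N` for some `k` is stable under the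
`π_j` up to denominators. Expanding `r = ∑ π_j(r) ^ p β_j` gives `γ J ⊆ J ^ 2` with `γ` dividing a
power of `c`, and the determinant trick puts a power of `γ` in `J`.

Trace: `N ↦ f^! N` and `N' ↦ Tr(N')` form a Galois connection, and both preserve the families
defining the test modules (`submodule_mem_testFamily`, `traceMap_mem_testFamily`). Minimality on
each side gives the two inclusions. For the trace, every `η ∈ Ass M` needs a prime above it, which
dominance supplies, and a functional `S/ξ → R/η` that is nonzero at `1`. -/

namespace CartierAction

/-! ### Submodules generated by operators of high degree -/

section Span

variable {p : ℕ} {R : Type u} [CommRing R] {C : CartierAlgebra.{u, v} p R}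
  {M : Type x} [AddCommGroup M] [Module R M] (A : CartierAction C M)

/-- The submodule `C_{≥ n} N` generated by the images of `N` under elements of degree `≥ n`. -/
def actSpan (n : ℕ) (N : Submodule R M) : Submodule R M :=
  Submodule.span R {y | ∃ e : ℕ, n ≤ e ∧ ∃ κ : C.gr e, ∃ m ∈ N, A.act κ m = y}

theorem act_mem_actSpan {n e : ℕ} (h : n ≤ e) (κ : C.gr e) {N : Submodule R M} {m : M}
    (hm : m ∈ N) : A.act κ m ∈ A.actSpan n N :=
  Submodule.subset_span ⟨e, h, κ, m, hm, rfl⟩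

theorem actSpan_le {n : ℕ} {N N' : Submodule R M}
    (h : ∀ (e : ℕ) (_ : n ≤ e) (κ : C.gr e), ∀ m ∈ N, A.act κ m ∈ N') : A.actSpan n N ≤ N' := by
  refine Submodule.span_le.mpr ?_
  rintro _ ⟨e, he, κ, m, hm, rfl⟩
  exact h e he κ m hm

theorem actSpan_mono (n : ℕ) {N N' : Submodule R M} (h : N ≤ N') :
    A.actSpan n N ≤ A.actSpan n N' :=
  A.actSpan_le fun _ he κ _ hm => A.act_mem_actSpan he κ (h hm)

theorem plus_mono : Monotone A.plus := fun _ _ h => A.actSpan_mono 1 h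

theorem act_actSpan_mem {n d : ℕ} (κ : C.gr d) {N : Submodule R M} {y : M}
    (hy : y ∈ A.actSpan n N) : A.act κ y ∈ A.actSpan (d + n) N := by
  induction hy using Submodule.span_induction generalizing d with
  | mem y hy =>
    obtain ⟨e, he, lam, m, hm, rfl⟩ := hy
    rw [← A.act_mul rfl]
    exact A.act_mem_actSpan (by omega) _ hm
  | zero => simp
  | add y z _ _ h₁ h₂ => rw [map_add]; exact add_mem (h₁ κ) (h₂ κ)
  | smul r y _ h => rw [← A.act_smul_left]; exact h _

theorem actSpan_anti {n n' : ℕ} (h : n ≤ n') (N : Submodule R M) :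
    A.actSpan n' N ≤ A.actSpan n N :=
  A.actSpan_le fun _ he κ _ hm => A.act_mem_actSpan (h.trans he) κ hm

theorem isCartierSubmodule_actSpan (n : ℕ) (N : Submodule R M) :
    A.IsCartierSubmodule (A.actSpan n N) :=
  fun _ κ _ hm => A.actSpan_anti (Nat.le_add_left _ _) N (A.act_actSpan_mem κ hm)

theorem le_actSpan_zero (N : Submodule R M) : N ≤ A.actSpan 0 N := fun m hm => by
  have := A.act_mem_actSpan (le_refl 0) (C.ofR 1) hm
  rwa [A.act_ofR, one_smul] at this

theorem actSpan_actSpan_le (m n : ℕ) (N : Submodule R M) :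
    A.actSpan m (A.actSpan n N) ≤ A.actSpan (m + n) N :=
  A.actSpan_le fun _ he κ _ hy =>
    A.actSpan_anti (Nat.add_le_add_right he n) N (A.act_actSpan_mem κ hy)

/-- A product of `n` operators of positive degree has degree at least `n`. Passing to `C_{≥ n}`
discards the factorization but keeps the bound `p ^ e ≥ n`, which is what later arguments use. -/
theorem plus_iterate_le_actSpan (n : ℕ) (N : Submodule R M) :
    A.plus^[n] N ≤ A.actSpan n N := by
  induction n with
  | zero => exact A.le_actSpan_zero N
  | succ n ih =>
    rw [Function.iterate_succ_apply', Nat.add_comm]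
    exact (A.plus_mono ih).trans (A.actSpan_actSpan_le 1 n N)

variable {A} in
theorem IsCartierSubmodule.actSpan_le {N : Submodule R M} (hN : A.IsCartierSubmodule N) (n : ℕ) :
    A.actSpan n N ≤ N :=
  CartierAction.actSpan_le A fun e _ κ m hm => hN e κ m hm

variable {A} in
theorem IsCartierSubmodule.plus_le {N : Submodule R M} (hN : A.IsCartierSubmodule N) :
    A.plus N ≤ N :=
  hN.actSpan_le 1

variable {A} in
theorem IsCartierSubmodule.plus_iterate {N : Submodule R M} (hN : A.IsCartierSubmodule N)
    (n : ℕ) : A.IsCartierSubmodule (A.plus^[n] N) := by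
  cases n with
  | zero => exact hN
  | succ n =>
    rw [Function.iterate_succ_apply']
    exact A.isCartierSubmodule_actSpan 1 _

variable {A} in
theorem IsCartierSubmodule.plus_iterate_anti {N : Submodule R M} (hN : A.IsCartierSubmodule N) :
    Antitone fun n => A.plus^[n] N :=
  antitone_nat_of_succ_le fun n => by
    rw [Function.iterate_succ_apply']
    exact (hN.plus_iterate n).plus_le

variable {A} in
theorem IsCartierSubmodule.iSup {ι : Sort*} {N : ι → Submodule R M}
    (hN : ∀ i, A.IsCartierSubmodule (N i)) : A.IsCartierSubmodule (⨆ i, N i) := by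
  intro e κ m hm
  induction hm using Submodule.iSup_induction' with
  | mem i x hx => exact Submodule.mem_iSup_of_mem i (hN i e κ x hx)
  | zero => simp
  | add x y _ _ hx hy => rw [map_add]; exact add_mem hx hy

/-- Multiplication by `c` moves into `C_{≥ n} N` as multiplication by `c ^ (p ^ e)`, `e ≥ n`. -/
theorem smul_mem_actSpan {n : ℕ} {N N' : Submodule R M} {c : R}
    (h : ∀ e, n ≤ e → ∀ m ∈ N, c ^ p ^ e • m ∈ N') {y : M} (hy : y ∈ A.actSpan n N) :
    c • y ∈ A.actSpan n N' := by
  have : A.actSpan n N ≤ (A.actSpan n N').comap (LinearMap.lsmul R M c) :=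
    A.actSpan_le fun e he κ m hm => by
      simp only [Submodule.mem_comap, LinearMap.lsmul_apply, ← A.act_pow_smul]
      exact A.act_mem_actSpan he κ (h e he m hm)
  exact this hy

variable [Fact p.Prime]

theorem smul_mem_plus_iterate (n : ℕ) {N N' : Submodule R M} {c : R}
    (h : ∀ m ∈ N, c • m ∈ N') {y : M} (hy : y ∈ A.plus^[n] N) : c • y ∈ A.plus^[n] N' := by
  induction n generalizing y with
  | zero => exact h y hy
  | succ n ih =>
    rw [Function.iterate_succ_apply'] at hy ⊢
    refine A.smul_mem_actSpan (fun e _ m hm => ?_) hy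
    rw [← Nat.sub_add_cancel (Nat.one_le_pow e p (Fact.out : p.Prime).pos), pow_succ, mul_smul]
    exact Submodule.smul_mem _ _ (ih hm)

theorem pow_smul_mem_plus_iterate {Q : Submodule R M} {c : R} (h : ∀ m ∈ Q, c • m ∈ A.plus Q)
    (n : ℕ) {y : M} (hy : y ∈ Q) : c ^ n • y ∈ A.plus^[n] Q := by
  induction n generalizing y with
  | zero => simpa using hy
  | succ n ih =>
    rw [pow_succ', mul_smul, Function.iterate_succ_apply]
    exact A.smul_mem_plus_iterate n h (ih hy)

/-- If `c Q ⊆ C₊ Q`, then `c ^ 3 Q` lies in every Cartier submodule that contains `c ^ k Q` for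
some `k`. -/
theorem pow_three_smul_mem {Q N : Submodule R M} {c : R} (h : ∀ m ∈ Q, c • m ∈ A.plus Q)
    (hN : A.IsCartierSubmodule N) {k : ℕ} (hk : ∀ m ∈ Q, c ^ k • m ∈ N) {m : M} (hm : m ∈ Q) :
    c ^ 3 • m ∈ N := by
  have hp : p.Prime := Fact.out
  set L : Submodule R M := Q.map (LinearMap.lsmul R M (c ^ 2)) with hL
  have hLmem : ∀ {y}, y ∈ Q → c ^ 2 • y ∈ L := fun hy => ⟨_, hy, rfl⟩
  -- One factor `c` puts the element in `C₊ Q`; the other, moved inside an operator of degree `e ≥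
  -- 1`, becomes `c ^ (p ^ e)` with `p ^ e ≥ 2`, so the arguments lie in `L` again.
  have hLL : L ≤ A.plus L := by
    rintro _ ⟨y, hy, rfl⟩
    rw [LinearMap.lsmul_apply, sq, mul_smul]
    refine A.smul_mem_actSpan (fun e he y hy => ?_) (h y hy)
    have h2 : 2 ≤ p ^ e := hp.two_le.trans (Nat.le_self_pow (by omega) p)
    rw [← Nat.sub_add_cancel h2, pow_add, mul_smul]
    exact L.smul_mem _ (hLmem hy)
  have hLn : ∀ n, L ≤ A.plus^[n] L := fun n => by
    induction n with
    | zero => exact le_rfl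
    | succ n ih =>
      rw [Function.iterate_succ_apply']
      exact hLL.trans (A.plus_mono ih)
  -- Now `L ⊆ C_{≥ k} L`, and the third factor `c` becomes `c ^ (p ^ e)` with `p ^ e ≥ k`, enough to
  -- push `L` into `N` whatever `k` is.
  have key : c • c ^ 2 • m ∈ A.actSpan k N := by
    refine A.smul_mem_actSpan (fun e he y hy => ?_)
      (A.plus_iterate_le_actSpan k L (hLn k (hLmem hm)))
    obtain ⟨z, hz, rfl⟩ := hy
    have h2 : k ≤ p ^ e := he.trans (Nat.lt_pow_self hp.one_lt).le
    rw [LinearMap.lsmul_apply, ← Nat.sub_add_cancel h2, pow_add, mul_smul,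
      smul_comm (c ^ k)]
    exact N.smul_mem _ (N.smul_mem _ (hk z hz))
  rw [pow_succ', mul_smul]
  exact hN.actSpan_le k key

end Span

end CartierAction

/-! ### Clearing denominators, and localization of `C_{≥ n} N` -/

theorem Submodule.FG.exists_smul_mem {R : Type*} [CommRing R] {M : Type*} [AddCommGroup M]
    [Module R M] {L : Submodule R M} (hL : L.FG) (N : Submodule R M) (W : Submonoid R)
    (h : ∀ x ∈ L, ∃ c ∈ W, c • x ∈ N) : ∃ c ∈ W, ∀ x ∈ L, c • x ∈ N := by
  classical
  obtain ⟨s, rfl⟩ := hL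
  choose! f hfW hf using h
  refine ⟨∏ x ∈ s, f x, Submonoid.prod_mem _ fun x hx => hfW x (Submodule.subset_span hx), ?_⟩
  have : Submodule.span R (s : Set M) ≤ N.comap (LinearMap.lsmul R M (∏ x ∈ s, f x)) := by
    refine Submodule.span_le.mpr fun x hx => ?_
    simp only [Submodule.comap_coe, Set.mem_preimage, LinearMap.lsmul_apply, SetLike.mem_coe]
    rw [← Finset.prod_erase_mul s f hx, mul_smul]
    exact N.smul_mem _ (hf x (Submodule.subset_span hx))
  exact fun x hx => this hx

section Localized

variable {R : Type u} [CommRing R] {M : Type x} [AddCommGroup M] [Module R M] {W : Submonoid R}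

theorem LocalizedModule.mk_mem_localized {N : Submodule R M} {m : M} (hm : m ∈ N) (s : W) :
    LocalizedModule.mk m s ∈ N.localized W :=
  ⟨m, hm, s, by rw [IsLocalizedModule.mk_eq_mk']⟩

theorem LocalizedModule.mem_localized_iff {N : Submodule R M} {y : LocalizedModule W M} :
    y ∈ N.localized W ↔ ∃ m ∈ N, ∃ s : W, y = LocalizedModule.mk m s := by
  constructor
  · rintro ⟨m, hm, s, rfl⟩
    exact ⟨m, hm, s, (IsLocalizedModule.mk_eq_mk' s m).symm⟩
  · rintro ⟨m, hm, s, rfl⟩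
    exact mk_mem_localized hm s

theorem LocalizedModule.mk_mem_localized_iff {N : Submodule R M} {m : M} {s : W} :
    LocalizedModule.mk m s ∈ N.localized W ↔ ∃ c ∈ W, c • m ∈ N := by
  rw [mem_localized_iff]
  constructor
  · rintro ⟨n, hn, t, h⟩
    obtain ⟨c, hc⟩ := LocalizedModule.mk_eq.mp h
    refine ⟨c * t, mul_mem c.2 t.2, ?_⟩
    simp only [Submonoid.smul_def] at hc
    rw [mul_smul, hc]
    exact N.smul_mem _ (N.smul_mem _ hn)
  · rintro ⟨c, hc, h⟩
    exact ⟨c • m, h, ⟨c, hc⟩ * s, (LocalizedModule.mk_cancel_common_left ⟨c, hc⟩ s m).symm⟩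

end Localized

namespace CartierAction

section Localization

variable {p : ℕ} [Fact p.Prime] {R : Type u} [CommRing R] [CharP R p]
  {C : CartierAlgebra.{u, v} p R} {M : Type x} [AddCommGroup M] [Module R M]
  (A : CartierAction C M) (W : Submonoid R)

theorem exists_mk_pow_of_mem_localized (p : ℕ) [Fact p.Prime] {N : Submodule R M} (e : ℕ)
    {y : LocalizedModule W M} (hy : y ∈ N.localized W) :
    ∃ m ∈ N, ∃ t : W, y = LocalizedModule.mk m (t ^ p ^ e) := by
  obtain ⟨m, hm, t, rfl⟩ := LocalizedModule.mem_localized_iff.mp hy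
  refine ⟨t ^ (p ^ e - 1) • m, N.smul_mem (t ^ (p ^ e - 1) : W).1 hm, t, ?_⟩
  have h1 : 1 ≤ p ^ e := Nat.one_le_pow e p (Fact.out : p.Prime).pos
  conv_rhs => rw [← Nat.sub_add_cancel h1, Nat.add_sub_cancel, pow_succ]
  rw [LocalizedModule.mk_cancel_common_left]

theorem localization_act_tmul {e : ℕ} (a : Localization W) (κ : C.gr e)
    (y : LocalizedModule W M) :
    (A.localization W).act (e := e) (a ⊗ₜ[R] κ : Localization W ⊗[R] C.gr e) y =
      A.locFun W κ (a • y) := rfl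

/-- Every fraction can be written with a denominator `t ^ (p ^ e)`, and then an operator of degree
`e` acts on the numerator and leaves the denominator `t`. -/
theorem actSpan_localized (n : ℕ) (N : Submodule R M) :
    (A.localization W).actSpan n (N.localized W) = (A.actSpan n N).localized W := by
  apply le_antisymm
  · refine (A.localization W).actSpan_le fun e he κ y hy => ?_
    change Localization W ⊗[R] C.gr e at κ
    induction κ using TensorProduct.induction_on with
    | zero =>
      have : (A.localization W).act (e := e) (0 : Localization W ⊗[R] C.gr e) y = 0 := by
        erw [map_zero]; rfl
      rw [this]; exact zero_mem _
    | add κ κ' h₁ h₂ =>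
      have : (A.localization W).act (e := e) (κ + κ' : Localization W ⊗[R] C.gr e) y =
        (A.localization W).act (e := e) κ y + (A.localization W).act (e := e) κ' y := by
        erw [map_add]; rfl
      rw [this]; exact add_mem h₁ h₂
    | tmul a κ =>
      rw [localization_act_tmul]
      obtain ⟨m, hm, t, h⟩ :=
        exists_mk_pow_of_mem_localized W p e ((N.localized W).smul_mem a hy)
      rw [h, locFun_mk_pow]
      exact LocalizedModule.mk_mem_localized (A.act_mem_actSpan he κ hm) t
  · intro y hy
    obtain ⟨m, hm, s, rfl⟩ := LocalizedModule.mem_localized_iff.mp hy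
    have hms : LocalizedModule.mk m s = Localization.mk 1 s • LocalizedModule.mk m (1 : W) := by
      rw [LocalizedModule.mk_smul_mk, one_smul, mul_one]
    rw [hms]
    refine Submodule.smul_mem _ _ ?_
    clear hms hy
    induction hm using Submodule.span_induction with
    | mem y hy =>
      obtain ⟨e, he, κ, m, hm, rfl⟩ := hy
      have : LocalizedModule.mk (A.act κ m) (1 : W) = (A.localization W).act (e := e)
          ((1 : Localization W) ⊗ₜ[R] κ : Localization W ⊗[R] C.gr e)
          (LocalizedModule.mk m 1) := by
        rw [localization_act_tmul, one_smul, ← locFun_mk_pow, one_pow]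
      rw [this]
      exact (A.localization W).act_mem_actSpan he _ (LocalizedModule.mk_mem_localized hm 1)
    | zero => simp
    | add x y _ _ hx hy => rw [← mk_add_mk_same]; exact add_mem hx hy
    | smul r x _ hx =>
      have : LocalizedModule.mk (r • x) (1 : W) =
          (algebraMap R (Localization W) r) • LocalizedModule.mk x 1 := by
        rw [algebraMap_smul, LocalizedModule.smul'_mk]
      rw [this]
      exact Submodule.smul_mem _ _ hx

theorem plus_iterate_localized (n : ℕ) (N : Submodule R M) :
    (A.localization W).plus^[n] (N.localized W) = (A.plus^[n] N).localized W := by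
  induction n with
  | zero => rfl
  | succ n ih =>
    rw [Function.iterate_succ_apply', Function.iterate_succ_apply', ih]
    exact A.actSpan_localized W 1 _

end Localization

/-! ### The nil-isomorphism condition without localization -/

section NilAt

variable {p : ℕ} [Fact p.Prime] {R : Type u} [CommRing R]
  {C : CartierAlgebra.{u, v} p R} {M : Type x} [AddCommGroup M] [Module R M]
  (A : CartierAction C M)

/-- Generically on `V(η)`, the submodule `N` contains `C₊ ^ n M[η]` for some `n`, where `M[η]`
is the submodule of elements annihilated by `η`. -/
def IsNilAt (η : Ideal R) (N : Submodule R M) : Prop :=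
  ∃ n : ℕ, ∃ c ∉ η, ∀ m ∈ A.plus^[n] (Submodule.torsionBySet R M η), c • m ∈ N

variable {A} in
theorem IsNilAt.mono {η : Ideal R} {N N' : Submodule R M} (h : A.IsNilAt η N) (hN : N ≤ N') :
    A.IsNilAt η N' := by
  obtain ⟨n, c, hc, h⟩ := h
  exact ⟨n, c, hc, fun m hm => hN (h m hm)⟩

theorem isCartierSubmodule_torsionBySet (η : Ideal R) :
    A.IsCartierSubmodule (Submodule.torsionBySet R M η) := by
  intro e κ m hm
  rw [Submodule.mem_torsionBySet_iff] at hm ⊢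
  intro a
  rw [← A.act_pow_smul]
  have := hm ⟨(a : R) ^ p ^ e, Ideal.pow_mem_of_mem _ a.2 _ (Nat.pos_of_ne_zero
    (pow_ne_zero _ (Fact.out : p.Prime).ne_zero))⟩
  rw [this, map_zero]

/-- Since `η` is finitely generated, one denominator outside `η` kills all of `η m` as soon as each
`a m` with `a ∈ η` vanishes locally. -/
theorem torsionBySet_localized [IsNoetherianRing R] (η : Ideal R) [η.IsPrime] :
    Submodule.torsionBySet (Localization.AtPrime η) (LocalizedModule η.primeCompl M)
        (η.map (algebraMap R (Localization.AtPrime η))) =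
      (Submodule.torsionBySet R M η).localized η.primeCompl := by
  apply le_antisymm
  · intro y hy
    induction y using LocalizedModule.induction_on with
    | h m s =>
      rw [LocalizedModule.mk_mem_localized_iff]
      have hfg : (Submodule.map (LinearMap.toSpanSingleton R M m) (η : Submodule R R)).FG :=
        (IsNoetherian.noetherian η).map _
      obtain ⟨c, hc, h⟩ := hfg.exists_smul_mem ⊥ η.primeCompl (by
        rintro _ ⟨a, ha, rfl⟩
        rw [Submodule.mem_torsionBySet_iff] at hy
        have h0 := hy ⟨algebraMap R _ a, Ideal.mem_map_of_mem _ ha⟩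
        change algebraMap R (Localization.AtPrime η) a • _ = _ at h0
        rw [algebraMap_smul, LocalizedModule.smul'_mk] at h0
        obtain ⟨c, hc⟩ := (IsLocalizedModule.mk'_eq_zero' (LocalizedModule.mkLinearMap
          η.primeCompl M) s).mp (by rw [← IsLocalizedModule.mk_eq_mk']; exact h0)
        exact ⟨c, c.2, by simpa [Submonoid.smul_def] using hc⟩)
      refine ⟨c, hc, ?_⟩
      rw [Submodule.mem_torsionBySet_iff]
      rintro ⟨a, ha⟩
      have := h (a • m) ⟨a, ha, rfl⟩
      rw [Submodule.mem_bot] at this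
      rw [smul_comm]
      exact this
  · intro y hy
    obtain ⟨m, hm, s, rfl⟩ := LocalizedModule.mem_localized_iff.mp hy
    rw [Submodule.mem_torsionBySet_iff] at hm ⊢
    rintro ⟨a, ha⟩
    change a • LocalizedModule.mk m s = 0
    induction ha using Submodule.span_induction with
    | mem a ha =>
      obtain ⟨b, hb, rfl⟩ := ha
      rw [algebraMap_smul, LocalizedModule.smul'_mk, hm ⟨b, hb⟩, LocalizedModule.zero_mk]
    | zero => rw [zero_smul]
    | add a b _ _ ha hb => rw [add_smul, ha, hb, add_zero]
    | smul r a _ ha => rw [smul_assoc, ha, smul_zero]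

theorem mem_localCohomologyZero_top {R : Type u} [CommRing R] {M : Type x} [AddCommGroup M]
    [Module R M] {I : Ideal R} {m : M} :
    m ∈ localCohomologyZero I (⊤ : Submodule R M) ↔ ∃ k : ℕ, ∀ a ∈ I ^ k, a • m = 0 :=
  ⟨fun h => h.2, fun h => ⟨trivial, h⟩⟩

theorem torsionBySet_le_localCohomologyZero {R : Type u} [CommRing R] {M : Type x}
    [AddCommGroup M] [Module R M] (I : Ideal R) :
    Submodule.torsionBySet R M I ≤ localCohomologyZero I (⊤ : Submodule R M) := fun m hm =>
  mem_localCohomologyZero_top.mpr ⟨1, fun a ha => by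
    rw [pow_one] at ha
    exact (Submodule.mem_torsionBySet_iff _ _).mp hm ⟨a, ha⟩⟩

/-- On a finite module, `H⁰_I` is annihilated by a power of `I`. -/
theorem exists_pow_smul_localCohomologyZero {R : Type u} [CommRing R] [IsNoetherianRing R]
    {M : Type x} [AddCommGroup M] [Module R M] [Module.Finite R M] (I : Ideal R) :
    ∃ k : ℕ, ∀ m ∈ localCohomologyZero I (⊤ : Submodule R M), ∀ a ∈ I ^ k, a • m = 0 := by
  obtain ⟨s, hs⟩ : (localCohomologyZero I (⊤ : Submodule R M)).FG := IsNoetherian.noetherian _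
  have hmem : ∀ m ∈ s, ∃ k : ℕ, ∀ a ∈ I ^ k, a • m = 0 := fun m hm =>
    mem_localCohomologyZero_top.mp (hs ▸ Submodule.subset_span hm)
  choose! f hf using hmem
  refine ⟨s.sup f, fun m hm a ha => ?_⟩
  rw [← hs] at hm
  have : Submodule.span R (s : Set M) ≤ LinearMap.ker (LinearMap.lsmul R M a) :=
    Submodule.span_le.mpr fun x hx => hf x hx a (Ideal.pow_le_pow_right (Finset.le_sup hx) ha)
  exact this hm

/-- If `I ^ k` kills `H⁰_I` and `e ≥ k`, then `a κ(m) = κ(a ^ (p ^ e) m) = 0` for `a ∈ I`, because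
`p ^ e ≥ k`. Up to nilpotence, `H⁰_I` may therefore be replaced by the `I`-torsion. -/
theorem exists_plus_iterate_localCohomologyZero_le [IsNoetherianRing R] [Module.Finite R M]
    (I : Ideal R) :
    ∃ k : ℕ, A.plus^[k] (localCohomologyZero I ⊤) ≤ Submodule.torsionBySet R M I := by
  obtain ⟨k, hk⟩ := exists_pow_smul_localCohomologyZero (M := M) I
  refine ⟨k, (A.plus_iterate_le_actSpan k _).trans (A.actSpan_le fun e he κ m hm => ?_)⟩
  rw [Submodule.mem_torsionBySet_iff]
  rintro ⟨a, ha⟩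
  change a • _ = _
  have h2 : k ≤ p ^ e := he.trans (Nat.lt_pow_self (Fact.out : p.Prime).one_lt).le
  rw [← A.act_pow_smul, hk m hm _ (Ideal.pow_le_pow_right h2 (Ideal.pow_mem_pow ha _)), map_zero]

theorem plus_iterate_torsionBySet_le (n : ℕ) (I : Ideal R) :
    A.plus^[n] (Submodule.torsionBySet R M I) ≤ Submodule.torsionBySet R M I :=
  (A.isCartierSubmodule_torsionBySet I).plus_iterate_anti (Nat.zero_le n)

theorem isNilIsoInclusion_iff_isNilAt [CharP R p] [IsNoetherianRing R] [Module.Finite R M]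
    (η : Ideal R) [η.IsPrime] (N : Submodule R M) :
    (A.localization η.primeCompl).IsNilIsoInclusion
      (localCohomologyZero (η.map (algebraMap R (Localization.AtPrime η)))
        (N.localized η.primeCompl))
      (localCohomologyZero (η.map (algebraMap R (Localization.AtPrime η))) ⊤) ↔
    A.IsNilAt η N := by
  set I : Ideal (Localization.AtPrime η) := η.map (algebraMap R (Localization.AtPrime η)) with hI
  set A' := A.localization η.primeCompl with hA'
  constructor
  · rintro ⟨-, n, hn⟩
    refine ⟨n, ?_⟩
    refine (IsNoetherian.noetherian (A.plus^[n] (Submodule.torsionBySet R M η))).exists_smul_mem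
      N η.primeCompl fun x hx => ?_
    have h1 : LocalizedModule.mk x (1 : η.primeCompl) ∈
        A'.plus^[n] ((Submodule.torsionBySet R M η).localized η.primeCompl) := by
      rw [A.plus_iterate_localized]
      exact LocalizedModule.mk_mem_localized hx 1
    rw [← torsionBySet_localized] at h1
    have h2 := hn (A'.plus_mono.iterate n (torsionBySet_le_localCohomologyZero I) h1)
    exact LocalizedModule.mk_mem_localized_iff.mp h2.1
  · rintro ⟨n, c, hc, h⟩
    have : Module.Finite (Localization.AtPrime η) (LocalizedModule η.primeCompl M) :=
      Module.Finite.of_isLocalizedModule η.primeCompl (LocalizedModule.mkLinearMap η.primeCompl M)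
    refine ⟨fun m hm => mem_localCohomologyZero_top.mpr hm.2, ?_⟩
    obtain ⟨k, hk⟩ := A'.exists_plus_iterate_localCohomologyZero_le I
    -- The first `k` applications of `C₊` carry `H⁰` into the `η`-torsion, the remaining `n` carry
    -- that into `N_η`.
    refine ⟨n + k, ?_⟩
    rw [Function.iterate_add_apply]
    intro y hy
    have h1 := A'.plus_mono.iterate n hk hy
    refine ⟨?_, mem_localCohomologyZero_top.mp (torsionBySet_le_localCohomologyZero I
      (A'.plus_iterate_torsionBySet_le n I h1))⟩
    rw [torsionBySet_localized, A.plus_iterate_localized] at h1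
    obtain ⟨m, hm, s, rfl⟩ := LocalizedModule.mem_localized_iff.mp h1
    exact LocalizedModule.mk_mem_localized_iff.mpr ⟨c, hc, h m hm⟩

theorem mem_testFamily_iff [CharP R p] [IsNoetherianRing R] [Module.Finite R M]
    {N : Submodule R M} : N ∈ A.testFamily ↔
      A.IsCartierSubmodule N ∧ ∀ η ∈ associatedPrimes R M, A.IsNilAt η N := by
  refine and_congr_right fun _ => ⟨fun h η hη => ?_, fun h η _ hη => ?_⟩
  · have : η.IsPrime := hη.isPrime
    exact (A.isNilIsoInclusion_iff_isNilAt η N).mp (h η hη)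
  · exact (A.isNilIsoInclusion_iff_isNilAt η N).mpr (h η hη)

end NilAt

end CartierAction

/-! ### Additive maps and coinduction along Frobenius -/

/-- The additive maps `K → V`, with the `K`-module structure `(t • φ) s = φ (t s)`. -/
abbrev AdditiveMaps (K V : Type*) [CommRing K] [AddCommGroup V] : Type _ :=
  UpperShriek ℤ K V

namespace AdditiveMaps

variable {K V : Type*} [CommRing K] [AddCommGroup V]

theorem add_apply (φ ψ : AdditiveMaps K V) (s : K) : (φ + ψ) s = φ s + ψ s := rfl

theorem smul_apply (t : K) (φ : AdditiveMaps K V) (s : K) : (t • φ) s = φ (t * s) := rfl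

theorem ext {φ ψ : AdditiveMaps K V} (h : ∀ s, φ s = ψ s) : φ = ψ := UpperShriek.ext h

/-- Precomposition of an additive map with an additive endomorphism of the source. -/
def comp (φ : AdditiveMaps K V) (f : K →+ K) : AdditiveMaps K V :=
  (LinearMap.comp (φ : K →ₗ[ℤ] V) f.toIntLinearMap : K →ₗ[ℤ] V)

end AdditiveMaps

namespace UpperShriek

/-- `Φ ↦ Φ ∘ F` on additive maps, for a ring homomorphism `F`. -/
def precomp {K L V : Type*} [CommRing K] [CommRing L] [AddCommGroup V] (F : K →+* L) :
    AdditiveMaps L V →+ AdditiveMaps K V where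
  toFun Φ := (LinearMap.comp (Φ : L →ₗ[ℤ] V) F.toAddMonoidHom.toIntLinearMap : K →ₗ[ℤ] V)
  map_zero' := rfl
  map_add' _ _ := rfl

@[simp]
theorem precomp_apply {K L V : Type*} [CommRing K] [CommRing L] [AddCommGroup V] (F : K →+* L)
    (Φ : AdditiveMaps L V) (s : K) : precomp F Φ s = Φ (F s) := rfl

/-- The additive maps `Φ` such that `s ↦ Φ (t F(s))` lies in `P` for all `t`; this is
`Hom_K(L, P)` for the `K`-algebra `L` given by `F`. -/
def coind {K L V : Type*} [CommRing K] [CommRing L] [AddCommGroup V] (F : K →+* L)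
    (P : Submodule K (AdditiveMaps K V)) : Submodule L (AdditiveMaps L V) where
  carrier := {Φ | ∀ t : L, precomp F (t • Φ) ∈ P}
  zero_mem' t := by rw [smul_zero, map_zero]; exact P.zero_mem
  add_mem' {Φ Ψ} h₁ h₂ t := by rw [smul_add, map_add]; exact P.add_mem (h₁ t) (h₂ t)
  smul_mem' c Φ h t := by rw [smul_smul]; exact h _

theorem precomp_smul_map {K L V : Type*} [CommRing K] [CommRing L] [AddCommGroup V]
    (F : K →+* L) (r : K) (Φ : AdditiveMaps L V) :
    precomp F (F r • Φ) = r • precomp F Φ := by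
  ext s
  simp

/-- The coinduced space embeds in `Hom_K(L, P)`, whose dimension over `K` is `[L : K] · dim P` and
hence over `L` is `dim P`. -/
theorem finrank_coind_le {K L V : Type*} [Field K] [Field L] [AddCommGroup V] (F : K →+* L)
    (hF : F.Finite) (P : Submodule K (AdditiveMaps K V)) [hP : Module.Finite K P] :
    Module.Finite L (coind F P) ∧ Module.finrank L (coind F P) ≤ Module.finrank K P := by
  let : Algebra K L := F.toAlgebra
  have : Module.Finite K L := hF
  let X := UpperShriek K L P
  let j : coind F P →ₗ[L] X :=
    { toFun := fun Φ =>
        ({ toFun := fun t => ⟨precomp F (t • Φ.1), Φ.2 t⟩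
           map_add' := fun s t => Subtype.ext (by
            change precomp F ((s + t) • Φ.1) = precomp F (s • Φ.1) + precomp F (t • Φ.1)
            rw [add_smul, map_add])
           map_smul' := fun r t => Subtype.ext (by
            change precomp F ((F r * t) • Φ.1) = r • precomp F (t • Φ.1)
            rw [mul_smul, precomp_smul_map]) } : L →ₗ[K] P)
      map_add' := fun Φ Ψ => by
        refine UpperShriek.ext fun t => Subtype.ext ?_
        change precomp F (t • (Φ.1 + Ψ.1)) = precomp F (t • Φ.1) + precomp F (t • Ψ.1)
        rw [smul_add, map_add]
      map_smul' := fun c Φ => by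
        refine UpperShriek.ext fun t => Subtype.ext ?_
        change precomp F (t • c • Φ.1) = precomp F ((c * t) • Φ.1)
        rw [smul_smul, mul_comm] }
  have hj : Function.Injective j := by
    intro Φ Ψ h
    refine Subtype.ext (UpperShriek.ext fun t => ?_)
    have h1 : precomp F (t • Φ.1) = precomp F (t • Ψ.1) :=
      congrArg Subtype.val (DFunLike.congr_fun h t)
    simpa using DFunLike.congr_fun h1 1
  have : Module.Finite K X := inferInstanceAs (Module.Finite K (L →ₗ[K] P))
  have : Module.Finite L X := Module.Finite.of_restrictScalars_finite K L X
  have h1 : Module.finrank K X = Module.finrank K L * Module.finrank K P :=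
    Module.finrank_linearMap K K L P
  have h2 : Module.finrank K L * Module.finrank L X = Module.finrank K X :=
    Module.finrank_mul_finrank K L X
  have h3 : 0 < Module.finrank K L := Module.finrank_pos
  refine ⟨Module.Finite.of_injective j hj, ?_⟩
  calc Module.finrank L (coind F P) ≤ Module.finrank L X :=
        LinearMap.finrank_le_finrank_of_injective hj
    _ = Module.finrank K P := Nat.eq_of_mul_eq_mul_left h3 (h2.trans h1)

/-- A tower of submodules with `P (b + 1) ⊆ Hom_K(F_* K, P b)` is eventually given by
coinduction. -/
theorem exists_eq_coind {K V : Type*} [Field K] [AddCommGroup V] (F : K →+* K)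
    (hF : F.Finite) (P : ℕ → Submodule K (AdditiveMaps K V)) (h0 : Module.Finite K (P 0))
    (hP : ∀ b, P (b + 1) ≤ coind F (P b)) : ∃ b, P (b + 1) = coind F (P b) := by
  have hfin : ∀ b, Module.Finite K (P b) := fun b => by
    induction b with
    | zero => exact h0
    | succ b ih =>
      have := (finrank_coind_le F hF (P b)).1
      exact Submodule.finiteDimensional_of_le (hP b)
  have hle : ∀ b, Module.finrank K (P (b + 1)) ≤ Module.finrank K (coind F (P b)) := fun b => by
    have := (finrank_coind_le F hF (P b)).1
    exact Submodule.finrank_mono (hP b)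
  have hanti : Antitone fun b => Module.finrank K (P b) :=
    antitone_nat_of_succ_le fun b => (hle b).trans (finrank_coind_le F hF (P b)).2
  -- The dimensions form a nonincreasing sequence of naturals. Where two successive ones agree, the
  -- coinduced space squeezed between them has the same dimension.
  obtain ⟨b, hb⟩ := WellFoundedGT.monotone_chain_condition
    (α := ℕᵒᵈ) ⟨fun b => OrderDual.toDual (Module.finrank K (P b)), fun _ _ h => hanti h⟩
  refine ⟨b, ?_⟩
  have hb1 : Module.finrank K (P b) = Module.finrank K (P (b + 1)) := hb (b + 1) (Nat.le_succ b)
  have := (finrank_coind_le F hF (P b)).1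
  exact Submodule.eq_of_le_of_finrank_le (hP b) (hb1 ▸ (finrank_coind_le F hF (P b)).2)

end UpperShriek

/-! ### Finiteness of Frobenius, and a determinant trick -/

theorem RingHom.Finite.exists_dualBasis {K L : Type*} [Field K] [CommRing L] {F : K →+* L}
    (hF : F.Finite) : ∃ (n : ℕ) (b : Fin n → L) (π : Fin n → L →+ K),
      (∀ j x s, π j (F x * s) = x * π j s) ∧ ∀ s, s = ∑ j, F (π j s) * b j := by
  let : Algebra K L := F.toAlgebra
  have : Module.Finite K L := hF
  let B := Module.finBasis K L
  refine ⟨_, B, fun j => (B.coord j).toAddMonoidHom, fun j x s => ?_, fun s => ?_⟩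
  · exact (B.coord j).map_smul x s
  · exact (B.sum_repr s).symm

theorem RingHom.Finite.exists_generators {A B : Type*} [CommRing A] [CommRing B] {F : A →+* B}
    (hF : F.Finite) : ∃ (n : ℕ) (g : Fin n → B), ∀ s, ∃ r : Fin n → A, s = ∑ j, F (r j) * g j := by
  let : Algebra A B := F.toAlgebra
  have : Module.Finite A B := hF
  obtain ⟨n, g, hg⟩ := Module.Finite.exists_fin (R := A) (M := B)
  refine ⟨n, g, fun s => ?_⟩
  have hs : s ∈ Submodule.span A (Set.range g) := hg ▸ Submodule.mem_top
  obtain ⟨r, hr⟩ := (Submodule.mem_span_range_iff_exists_fun A).mp hs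
  exact ⟨r, hr.symm⟩

theorem RingHom.Finite.of_generators {A B : Type*} [CommRing A] [CommRing B] {F : A →+* B}
    {n : ℕ} (g : Fin n → B) (hg : ∀ s, ∃ r : Fin n → A, s = ∑ j, F (r j) * g j) : F.Finite := by
  let : Algebra A B := F.toAlgebra
  have : Module.Finite A B :=
    Module.Finite.of_surjective (Fintype.linearCombination A g) fun s => by
    obtain ⟨r, hr⟩ := hg s
    exact ⟨r, hr.symm⟩
  exact this

/-- Writing `a / t = a t ^ (p - 1) / t ^ p` makes the denominator a `p`-th power, so generators over
`R` still generate. -/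
theorem frobenius_finite_localization {p : ℕ} [Fact p.Prime] {R : Type*} [CommRing R] [CharP R p]
    (hR : (frobenius R p).Finite) (W : Submonoid R) [CharP (Localization W) p] :
    (frobenius (Localization W) p).Finite := by
  obtain ⟨n, g, hg⟩ := hR.exists_generators
  refine RingHom.Finite.of_generators (fun j => algebraMap R (Localization W) (g j)) fun s => ?_
  obtain ⟨⟨a, t⟩, hat⟩ := IsLocalization.surj W s
  obtain ⟨r, hr⟩ := hg (a * t ^ (p - 1))
  refine ⟨fun j => IsLocalization.mk' _ (r j) t, ?_⟩
  have hu : IsUnit (algebraMap R (Localization W) t ^ p) := (IsLocalization.map_units _ t).pow p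
  refine hu.mul_left_cancel ?_
  have h1 : algebraMap R (Localization W) t ^ p * s = algebraMap R _ (a * t ^ (p - 1)) := by
    rw [map_mul, ← hat, map_pow]
    conv_lhs => rw [← Nat.sub_add_cancel (Fact.out : p.Prime).one_le, pow_succ]
    ring
  rw [h1, hr, map_sum, Finset.mul_sum]
  refine Finset.sum_congr rfl fun j _ => ?_
  rw [map_mul, frobenius_def, frobenius_def, map_pow, ← mul_assoc, ← mul_pow,
    IsLocalization.mk'_spec']

theorem frobenius_finite_of_finite {p : ℕ} [Fact p.Prime] {R S : Type*} [CommRing R] [CharP R p]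
    [CommRing S] [CharP S p] [Algebra R S] [Module.Finite R S] (hR : (frobenius R p).Finite) :
    (frobenius S p).Finite := by
  have h : ((algebraMap R S).comp (frobenius R p)).Finite :=
    RingHom.Finite.comp (RingHom.finite_algebraMap.mpr inferInstance) hR
  have h2 : (algebraMap R S).comp (frobenius R p) = (frobenius S p).comp (algebraMap R S) := by
    ext r
    simp [frobenius_def]
  rw [h2] at h
  exact RingHom.Finite.of_comp_finite h

/-- In a Noetherian domain, if `γ J ⊆ J ^ 2` for a nonzero ideal `J`, then `J` contains a power
of `γ`. -/
theorem Ideal.exists_pow_mem_of_mul_mem_sq {D : Type*} [CommRing D] [IsDomain D]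
    [IsNoetherianRing D] {J : Ideal D} {γ d : D} (hd : d ∈ J) (hd0 : d ≠ 0)
    (h : ∀ s ∈ J, γ * s ∈ J * J) : ∃ n : ℕ, γ ^ n ∈ J := by
  have hJ : LinearMap.range (LinearMap.lsmul D J γ) ≤ J • (⊤ : Submodule D J) := by
    rintro _ ⟨⟨s, hs⟩, rfl⟩
    have h1 : γ * s ∈ (J • (⊤ : Submodule D J)).map J.subtype := by
      rw [Submodule.map_smul'', Submodule.map_top, Submodule.range_subtype]
      exact h s hs
    obtain ⟨y, hy, hy'⟩ := h1
    have : (LinearMap.lsmul D J γ) ⟨s, hs⟩ = y := Subtype.ext hy'.symm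
    rwa [this]
  -- Cayley–Hamilton for multiplication by `γ` on the module `J`, with image in `J · J`: the
  -- coefficient of degree `i` lies in `J ^ (deg q - i)`.
  obtain ⟨q, hq, -, hcoeff, hq0⟩ :=
    LinearMap.exists_monic_and_natDegree_eq_and_coeff_mem_pow_and_aeval_eq_zero D
      (LinearMap.lsmul D J γ) J hJ
  refine ⟨q.natDegree, ?_⟩
  -- The scalar `q(γ)` kills the nonzero element `d` of a domain.
  have h1 : q.eval γ = 0 := by
    have h2 : LinearMap.lsmul D J γ = algebraMap D (Module.End D J) γ := by ext; rfl
    rw [h2, Polynomial.aeval_algebraMap_apply] at hq0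
    have h3 := congrArg Subtype.val (LinearMap.congr_fun hq0 ⟨d, hd⟩)
    simp only [Polynomial.coe_aeval_eq_eval, Module.algebraMap_end_apply, LinearMap.zero_apply,
      Submodule.coe_smul, smul_eq_mul, ZeroMemClass.coe_zero, mul_eq_zero] at h3
    exact h3.resolve_right hd0
  rw [Polynomial.eval_eq_sum_range, Finset.sum_range_succ, hq.coeff_natDegree, one_mul] at h1
  rw [eq_neg_of_add_eq_zero_right h1]
  refine neg_mem (Ideal.sum_mem _ fun i hi => Ideal.mul_mem_right _ _ ?_)
  have hi' : q.natDegree - i ≠ 0 := by rw [Finset.mem_range] at hi; omega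
  exact Ideal.pow_le_self hi' (hcoeff i)

namespace CartierAction

/-! ### The tower of maps induced by operators of high degree -/

section Tower

variable {p : ℕ} [Fact p.Prime] {R : Type u} [CommRing R] [CharP R p]
  {C : CartierAlgebra.{u, v} p R} {M : Type x} [AddCommGroup M] [Module R M]
  (A : CartierAction C M)

/-- The additive map `s ↦ κ (s ^ (p ^ j) v)`. -/
def powAct {e : ℕ} (κ : C.gr e) (j : ℕ) (v : M) : AdditiveMaps R M :=
  (((A.act κ).comp (((smulAddHom R M).flip v).comp
    (frobPow p R R j).toAddMonoidHom)).toIntLinearMap : R →ₗ[ℤ] M)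

@[simp]
theorem powAct_apply {e : ℕ} (κ : C.gr e) (j : ℕ) (v : M) (s : R) :
    A.powAct κ j v s = A.act κ (s ^ p ^ j • v) := rfl

/-- The submodule of `Hom(F^b_* R, M)` generated by the maps `s ↦ κ (s ^ (p ^ (e - b)) v)`
with `κ` of degree `e ≥ b` and `v ∈ Q`. -/
def tower (Q : Submodule R M) (b : ℕ) : Submodule R (AdditiveMaps R M) :=
  Submodule.span R {φ | ∃ e : ℕ, b ≤ e ∧ ∃ κ : C.gr e, ∃ v ∈ Q, A.powAct κ (e - b) v = φ}

/-- For `e ≥ b + 1`, the factor `(t s ^ p) ^ (p ^ (e - b - 1))` splits as `s ^ (p ^ (e - b))` times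
a power of `t`, and the latter is absorbed into `v`. -/
theorem tower_succ_le (Q : Submodule R M) (b : ℕ) :
    A.tower Q (b + 1) ≤ UpperShriek.coind (frobenius R p) (A.tower Q b) := by
  refine Submodule.span_le.mpr ?_
  rintro _ ⟨e, he, κ, v, hv, rfl⟩ t
  refine Submodule.subset_span ⟨e, by omega, κ, t ^ p ^ (e - (b + 1)) • v, Q.smul_mem _ hv, ?_⟩
  ext s
  have h : e - b = e - (b + 1) + 1 := by omega
  simp only [powAct_apply, UpperShriek.precomp_apply, UpperShriek.smul_apply, frobenius_def, h]
  rw [smul_smul, mul_pow, ← pow_mul, ← pow_succ', mul_comm]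

theorem tower_apply_pow_mul {Q : Submodule R M} {b : ℕ} {φ : AdditiveMaps R M}
    (hφ : φ ∈ A.tower Q b) (x s : R) : φ (x ^ p ^ b * s) = x • φ s := by
  induction hφ using Submodule.span_induction generalizing s with
  | mem φ hφ =>
    obtain ⟨e, he, κ, v, hv, rfl⟩ := hφ
    rw [powAct_apply, powAct_apply, mul_pow, ← pow_mul, ← pow_add, Nat.add_sub_cancel' he,
      mul_smul, A.act_pow_smul]
  | zero => simp
  | add φ ψ _ _ h₁ h₂ => simp [h₁, h₂]
  | smul t φ _ h => rw [UpperShriek.smul_apply, UpperShriek.smul_apply, ← h]; congr 1; ring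

theorem exists_tower_apply_one {Q : Submodule R M} {b : ℕ} {v : M} (hv : v ∈ A.actSpan b Q) :
    ∃ φ ∈ A.tower Q b, φ 1 = v := by
  induction hv using Submodule.span_induction with
  | mem v hv =>
    obtain ⟨e, he, κ, v, hv, rfl⟩ := hv
    exact ⟨_, Submodule.subset_span ⟨e, he, κ, v, hv, rfl⟩, by simp⟩
  | zero => exact ⟨0, zero_mem _, rfl⟩
  | add v v' _ _ h₁ h₂ =>
    obtain ⟨φ, hφ, rfl⟩ := h₁
    obtain ⟨φ', hφ', rfl⟩ := h₂
    exact ⟨φ + φ', add_mem hφ hφ', rfl⟩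
  | smul x v _ h =>
    obtain ⟨φ, hφ, rfl⟩ := h
    exact ⟨x ^ p ^ b • φ, Submodule.smul_mem _ _ hφ, A.tower_apply_pow_mul hφ x 1⟩

/-- At level `0` a generator is `s ↦ κ(s ^ (p ^ e) v) = s κ(v)`, so the whole level lies in the
image of `M`. -/
theorem finite_tower_zero [IsNoetherianRing R] [Module.Finite R M] (Q : Submodule R M) :
    Module.Finite R (A.tower Q 0) := by
  let f : M →ₗ[R] AdditiveMaps R M :=
    { toFun := fun v => (((smulAddHom R M).flip v).toIntLinearMap : R →ₗ[ℤ] M)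
      map_add' := fun v v' => by
        ext s
        exact smul_add s v v'
      map_smul' := fun t v => by
        ext s
        change s • t • v = (t * s) • v
        rw [smul_smul, mul_comm] }
  have hle : A.tower Q 0 ≤ LinearMap.range f := by
    refine Submodule.span_le.mpr ?_
    rintro _ ⟨e, he, κ, v, hv, rfl⟩
    refine ⟨A.act κ v, ?_⟩
    ext s
    exact (A.act_pow_smul s κ v).symm
  exact Module.Finite.of_injective (Submodule.inclusion hle) (Submodule.inclusion_injective hle)

/-- Elements of the tower of a localization map `r` into `N`, up to a fixed denominator,
whenever `r Q ⊆ N`. -/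
theorem exists_smul_tower_apply_mem {W : Submonoid R} [CharP (Localization W) p]
    {Q : Submodule R M} {b : ℕ} {φ : AdditiveMaps (Localization W) (LocalizedModule W M)}
    (hφ : φ ∈ (A.localization W).tower (Q.localized W) b) (y : Localization W) :
    ∃ c ∈ W, ∀ N : Submodule R M, A.IsCartierSubmodule N → ∀ r : R, (∀ m ∈ Q, r • m ∈ N) →
      c • φ (y * algebraMap R _ r) ∈ N.map (LocalizedModule.mkLinearMap W M) := by
  -- The denominator `c` is fixed before `N` and `r`. The extra factor `y` is carried along for the
  -- scalar case, where `t • φ` at `y` is `φ` at `t y`.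
  induction hφ using Submodule.span_induction generalizing y with
  | mem φ hφ =>
    obtain ⟨e, he, κ, v, hv, rfl⟩ := hφ
    simp only [powAct_apply]
    change Localization W ⊗[R] C.gr e at κ
    induction κ using TensorProduct.induction_on with
    | zero =>
      refine ⟨1, one_mem _, fun N _ r _ => ?_⟩
      have : ∀ z, (A.localization W).act (e := e) (0 : Localization W ⊗[R] C.gr e) z = 0 :=
        fun z => by erw [map_zero]; rfl
      rw [this, smul_zero]
      exact zero_mem _
    | add κ κ' h₁ h₂ =>
      obtain ⟨c, hc, h₁⟩ := h₁
      obtain ⟨c', hc', h₂⟩ := h₂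
      refine ⟨c * c', mul_mem hc hc', fun N hN r hr => ?_⟩
      have : ∀ z, (A.localization W).act (e := e) (κ + κ' : Localization W ⊗[R] C.gr e) z =
        (A.localization W).act (e := e) κ z + (A.localization W).act (e := e) κ' z := fun z => by
        erw [map_add]; rfl
      rw [this, smul_add]
      refine add_mem ?_ ?_
      · rw [mul_comm, mul_smul]; exact Submodule.smul_mem _ _ (h₁ N hN r hr)
      · rw [mul_smul]; exact Submodule.smul_mem _ _ (h₂ N hN r hr)
    | tmul a κ =>
      have hz : a • y ^ p ^ (e - b) • v ∈ Q.localized W :=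
        Submodule.smul_mem _ _ (Submodule.smul_mem _ _ hv)
      obtain ⟨m, hm, t, h⟩ := exists_mk_pow_of_mem_localized W p e hz
      refine ⟨t, t.2, fun N hN r hr => ?_⟩
      rw [localization_act_tmul]
      have h1 : a • (y * algebraMap R (Localization W) r) ^ p ^ (e - b) • v =
          LocalizedModule.mk (r ^ p ^ (e - b) • m) (t ^ p ^ e) := by
        rw [mul_pow, mul_comm, mul_smul, smul_comm a, h, ← map_pow, algebraMap_smul,
          LocalizedModule.smul'_mk]
      rw [h1, locFun_mk_pow]
      refine ⟨A.act κ (r ^ p ^ (e - b) • m), hN e κ _ ?_, ?_⟩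
      · rw [← Nat.sub_add_cancel (Nat.one_le_pow (e - b) p (Fact.out : p.Prime).pos), pow_succ,
          mul_smul]
        exact N.smul_mem _ (hr m hm)
      · rw [LocalizedModule.mkLinearMap_apply, LocalizedModule.smul'_mk]
        exact (LocalizedModule.mk_cancel t _).symm
  | zero => exact ⟨1, one_mem _, fun N _ r _ => by simp⟩
  | add φ ψ _ _ h₁ h₂ =>
    obtain ⟨c, hc, h₁⟩ := h₁ y
    obtain ⟨c', hc', h₂⟩ := h₂ y
    refine ⟨c * c', mul_mem hc hc', fun N hN r hr => ?_⟩
    rw [AdditiveMaps.add_apply, smul_add]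
    refine add_mem ?_ ?_
    · rw [mul_comm, mul_smul]; exact Submodule.smul_mem _ _ (h₁ N hN r hr)
    · rw [mul_smul]; exact Submodule.smul_mem _ _ (h₂ N hN r hr)
  | smul t φ _ h =>
    obtain ⟨c, hc, h⟩ := h (t * y)
    refine ⟨c, hc, fun N hN r hr => ?_⟩
    rw [AdditiveMaps.smul_apply, ← mul_assoc]
    exact h N hN r hr

end Tower

end CartierAction

/-! ### A uniform multiplier over a domain -/

/-- Additive maps `π` of the fraction field with `π (x ^ p s) = x π(s)` have bounded denominators
on a domain whose Frobenius is finite. -/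
theorem exists_smul_eq_algebraMap_of_frobenius_finite {p : ℕ} [Fact p.Prime] {D : Type*}
    [CommRing D] [IsDomain D] [CharP D p] (hD : (frobenius D p).Finite) {n : ℕ}
    (π : Fin n → FractionRing D →+ FractionRing D)
    (hπ : ∀ j x s, π j (x ^ p * s) = x * π j s) :
    ∃ c : D, c ≠ 0 ∧ ∀ j r, ∃ y : D, c • π j (algebraMap D _ r) = algebraMap D _ y := by
  obtain ⟨k, g, hg⟩ := hD.exists_generators
  -- For `r = ∑ a_i ^ p g_i` one has `π_j(r) = ∑ a_i π_j(g_i)`, so only the finitely many `π_j(g_i)`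
  -- need a denominator.
  obtain ⟨⟨c, hc⟩, h⟩ := IsLocalization.exist_integer_multiples_of_finite (nonZeroDivisors D)
    fun q : Fin n × Fin k => π q.1 (algebraMap D (FractionRing D) (g q.2))
  refine ⟨c, nonZeroDivisors.ne_zero hc, fun j r => ?_⟩
  obtain ⟨a, ha⟩ := hg r
  choose y hy using h
  refine ⟨∑ i, a i * y (j, i), ?_⟩
  rw [ha, map_sum, map_sum, map_sum, Finset.smul_sum]
  refine Finset.sum_congr rfl fun i _ => ?_
  rw [map_mul, frobenius_def, map_pow, hπ, map_mul, hy (j, i), mul_smul_comm]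

namespace CartierAction

variable {p : ℕ} [Fact p.Prime] {D : Type u} [CommRing D] [IsDomain D] [IsNoetherianRing D]
  [CharP D p] {C : CartierAlgebra.{u, v} p D} {E : Type x} [AddCommGroup E] [Module D E]
  [Module.Finite D E] (A : CartierAction C E)

theorem localized_eq_of_smul_mem {R : Type*} [CommRing R] {M : Type*} [AddCommGroup M]
    [Module R M] {W : Submonoid R} {N N' : Submodule R M} (h : N' ≤ N) {c : R} (hc : c ∈ W)
    (hN : ∀ m ∈ N, c • m ∈ N') : N'.localized W = N.localized W := by
  ext y
  constructor
  · intro hy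
    obtain ⟨m, hm, s, rfl⟩ := LocalizedModule.mem_localized_iff.mp hy
    exact LocalizedModule.mk_mem_localized (h hm) s
  · intro hy
    obtain ⟨m, hm, s, rfl⟩ := LocalizedModule.mem_localized_iff.mp hy
    exact LocalizedModule.mk_mem_localized_iff.mpr ⟨c, hc, hN m hm⟩

/-- The constants of a test element: additive maps `π j` on `K = Frac D` dual to a basis of `K`
over `K ^ p`, and finitely many maps whose values at `1` generate `Q`, such that the composites
have bounded denominators. -/
theorem exists_bounded_frobenius_duals (hD : (frobenius D p).Finite) {Q : Submodule D E}
    (hQ : A.IsCartierSubmodule Q) {c₀ : D} (hc₀ : c₀ ≠ 0) (h₀ : ∀ m ∈ Q, c₀ • m ∈ A.plus Q) :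
    ∃ (n b : ℕ) (β : Fin n → FractionRing D) (π : Fin n → FractionRing D →+ FractionRing D),
      (∀ j x s, π j (x ^ p * s) = x * π j s) ∧ (∀ s, s = ∑ j, π j s ^ p * β j) ∧
      ∀ m ∈ Q, ∃ φ : AdditiveMaps (FractionRing D) (LocalizedModule (nonZeroDivisors D) E),
        (∀ y, φ (y ^ p ^ b) = y • LocalizedModule.mk m 1) ∧
        ∀ j, ∃ c : D, c ≠ 0 ∧ ∀ N : Submodule D E, A.IsCartierSubmodule N → ∀ r : D,
          (∀ m ∈ Q, r • m ∈ N) → c • φ (π j (algebraMap D _ r)) ∈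
            N.map (LocalizedModule.mkLinearMap (nonZeroDivisors D) E) := by
  have : CharP (FractionRing D) p :=
    charP_of_injective_algebraMap (IsFractionRing.injective D (FractionRing D)) p
  have : Module.Finite (FractionRing D) (LocalizedModule (nonZeroDivisors D) E) :=
    Module.Finite.of_isLocalizedModule (nonZeroDivisors D)
      (LocalizedModule.mkLinearMap (nonZeroDivisors D) E)
  have hK : (frobenius (FractionRing D) p).Finite := frobenius_finite_localization hD _
  set A' := A.localization (nonZeroDivisors D)
  set Q' := Q.localized (nonZeroDivisors D)
  have hplus : A'.plus Q' = Q' :=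
    (A.actSpan_localized _ 1 Q).trans
      (localized_eq_of_smul_mem hQ.plus_le (mem_nonZeroDivisors_of_ne_zero hc₀) h₀)
  obtain ⟨b, hb⟩ := UpperShriek.exists_eq_coind (frobenius (FractionRing D) p) hK (A'.tower Q')
    (A'.finite_tower_zero Q') (A'.tower_succ_le Q')
  obtain ⟨n, β, π, hπ, hβ⟩ := hK.exists_dualBasis
  refine ⟨n, b, β, π, hπ, hβ, fun m hm => ?_⟩
  have hm' : LocalizedModule.mk m 1 ∈ A'.actSpan b Q' := by
    refine A'.plus_iterate_le_actSpan b Q' ?_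
    rw [Function.iterate_fixed hplus]
    exact LocalizedModule.mk_mem_localized hm 1
  obtain ⟨φ, hφ, hφ1⟩ := A'.exists_tower_apply_one hm'
  refine ⟨φ, fun y => ?_, fun j => ?_⟩
  · rw [← hφ1, ← A'.tower_apply_pow_mul hφ, mul_one]
  · let ψ := AdditiveMaps.comp φ (π j)
    -- At the stable level, membership one step up can be tested by restriction along Frobenius: `s
    -- ↦ ψ(t s ^ p)` is just `π_j(t) • φ`.
    have hψ : ψ ∈ A'.tower Q' (b + 1) := by
      rw [hb]
      intro t
      have : UpperShriek.precomp (frobenius (FractionRing D) p) (t • ψ) = π j t • φ := by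
        refine AdditiveMaps.ext fun s => ?_
        change φ (π j (t * s ^ p)) = φ (π j t * s)
        rw [mul_comm t, ← frobenius_def, hπ, mul_comm]
      rw [this]
      exact Submodule.smul_mem _ _ hφ
    obtain ⟨c, hc, h⟩ := A.exists_smul_tower_apply_mem hψ 1
    refine ⟨c, nonZeroDivisors.ne_zero hc, fun N hN r hr => ?_⟩
    have := h N hN r hr
    rw [one_mul] at this
    exact this

/-- If `C₊ Q = Q` generically, then there is an open set on which `Q` has no proper Cartier
submodules that agree with `Q` generically. -/
theorem exists_pow_smul_mem_of_generic (hD : (frobenius D p).Finite) {Q : Submodule D E}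
    (hQ : A.IsCartierSubmodule Q) {c₀ : D} (hc₀ : c₀ ≠ 0) (h₀ : ∀ m ∈ Q, c₀ • m ∈ A.plus Q) :
    ∃ c : D, c ≠ 0 ∧ ∀ N : Submodule D E, A.IsCartierSubmodule N → ∀ d : D, d ≠ 0 →
      (∀ m ∈ Q, d • m ∈ N) → ∃ k : ℕ, ∀ m ∈ Q, c ^ k • m ∈ N := by
  classical
  have hp : p.Prime := Fact.out
  obtain ⟨n, b, β, π, hπ, hβ, hφ⟩ := A.exists_bounded_frobenius_duals hD hQ hc₀ h₀
  choose! φ hφ1 γ hγ0 hγ using hφ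
  obtain ⟨s, hs⟩ : Q.FG := IsNoetherian.noetherian Q
  obtain ⟨c₁, hc₁, hπD⟩ := exists_smul_eq_algebraMap_of_frobenius_finite hD π hπ
  obtain ⟨⟨c₂, hc₂⟩, hβD⟩ := IsLocalization.exist_integer_multiples_of_finite (nonZeroDivisors D) β
  obtain ⟨c₃, hc₃, hker⟩ := (IsNoetherian.noetherian
    (LinearMap.ker (LocalizedModule.mkLinearMap (nonZeroDivisors D) E))).exists_smul_mem ⊥
      (nonZeroDivisors D) fun x hx => by
        obtain ⟨c, hc⟩ := (IsLocalizedModule.eq_zero_iff (nonZeroDivisors D)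
          (LocalizedModule.mkLinearMap (nonZeroDivisors D) E)).mp hx
        exact ⟨c, c.2, hc⟩
  choose β' hβ' using hβD
  have hsQ : ∀ m ∈ s, m ∈ Q := fun m hm => hs ▸ Submodule.subset_span hm
  -- The factor `c₃` kills the kernel of `E → E_K`, `c₁` clears the `π j`, `c₂` the `β j`, and `γ m
  -- j` the map `φ m ∘ π j` for each generator `m` of `Q`. None of them depends on `N`.
  set c := c₃ * c₁ * c₂ * ∏ m ∈ s, ∏ j, γ m j with hc
  have hc0 : c ≠ 0 := mul_ne_zero (mul_ne_zero (mul_ne_zero (nonZeroDivisors.ne_zero hc₃) hc₁)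
    (nonZeroDivisors.ne_zero hc₂)) (Finset.prod_ne_zero_iff.mpr fun m hm =>
      Finset.prod_ne_zero_iff.mpr fun j _ => hγ0 m (hsQ m hm) j)
  have hdvd : ∀ m ∈ s, ∀ j, c₃ * γ m j ∣ c := fun m hm j => by
    refine mul_dvd_mul (Dvd.intro _ ((mul_assoc _ _ _).symm)) ?_
    exact (Finset.dvd_prod_of_mem (γ m) (Finset.mem_univ j)).trans
      (Finset.dvd_prod_of_mem (fun m => ∏ j, γ m j) hm)
  have hγc : c₁ ^ p * c₂ ∣ c ^ (p + 1) := by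
    rw [pow_succ]
    refine mul_dvd_mul (pow_dvd_pow_of_dvd ?_ p) ?_
    · exact ⟨c₃ * c₂ * ∏ m ∈ s, ∏ j, γ m j, by rw [hc]; ring⟩
    · exact ⟨c₃ * c₁ * ∏ m ∈ s, ∏ j, γ m j, by rw [hc]; ring⟩
  refine ⟨c, hc0, fun N hN d hd hdN => ?_⟩
  let J : Ideal D :=
    { carrier := {r | ∃ k : ℕ, ∀ m ∈ Q, (c ^ k * r) • m ∈ N}
      zero_mem' := ⟨0, fun m _ => by simp⟩
      add_mem' := by
        rintro r r' ⟨k, h⟩ ⟨k', h'⟩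
        refine ⟨k + k', fun m hm => ?_⟩
        have : c ^ (k + k') * (r + r') = c ^ k' * (c ^ k * r) + c ^ k * (c ^ k' * r') := by ring
        rw [this, add_smul, mul_smul (c ^ k'), mul_smul (c ^ k) (c ^ k' * r')]
        exact add_mem (N.smul_mem _ (h m hm)) (N.smul_mem _ (h' m hm))
      smul_mem' := by
        rintro t r ⟨k, h⟩
        refine ⟨k, fun m hm => ?_⟩
        rw [smul_eq_mul, mul_left_comm, mul_smul]
        exact N.smul_mem _ (h m hm) }
  -- The ideal `J` is stable under the maps `c₁ π_j`; this is where operators of `C` act on `N`.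
  have hπJ : ∀ r ∈ J, ∀ j (y : D), c₁ • π j (algebraMap D _ r) = algebraMap D _ y → y ∈ J := by
    rintro r ⟨k, hk⟩ j y hy
    have hgen : ∀ m ∈ s, (c ^ (k + 1) * y) • m ∈ N := fun m hm => by
      set z := c ^ k * y with hz
      -- Chosen so that `π_j(t ^ p c ^ (p k) r) = t c ^ k π_j(r)` equals the exact power `z ^ (p ^
      -- b)`, which `φ m` sends to `z • m`.
      obtain ⟨t, ht⟩ : ∃ t, t = z ^ (p ^ b - 1) * c₁ := ⟨_, rfl⟩
      have hr : ∀ m ∈ Q, (t ^ p * (c ^ (p * k) * r)) • m ∈ N := fun m hm => by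
        have h2 : k ≤ p * k := Nat.le_mul_of_pos_left k hp.pos
        rw [mul_smul, ← Nat.sub_add_cancel h2, pow_add, mul_assoc, mul_smul (c ^ (p * k - k))]
        exact N.smul_mem _ (N.smul_mem _ (hk m hm))
      have hπz : π j (algebraMap D _ (t ^ p * (c ^ (p * k) * r))) =
          algebraMap D (FractionRing D) z ^ p ^ b := by
        have h1 : 1 ≤ p ^ b := Nat.one_le_pow b p hp.pos
        have hz' : algebraMap D (FractionRing D) z = algebraMap D _ (c ^ k) *
            (algebraMap D _ c₁ * π j (algebraMap D _ r)) := by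
          rw [← Algebra.smul_def c₁, hy, hz, map_mul]
        rw [map_mul, map_pow, hπ, mul_comm p k, pow_mul, map_mul, map_pow _ (c ^ k), hπ,
          ht, map_mul _ _ c₁, map_pow _ z, mul_assoc, mul_left_comm (algebraMap D _ c₁), ← hz',
          ← pow_succ, Nat.sub_add_cancel h1]
      have hmem := hγ m (hsQ m hm) j N hN _ hr
      rw [hπz, hφ1 m (hsQ m hm)] at hmem
      obtain ⟨x, hx, hxe⟩ := hmem
      have hxe' : LocalizedModule.mkLinearMap (nonZeroDivisors D) E x =
          LocalizedModule.mkLinearMap (nonZeroDivisors D) E ((γ m j * z) • m) := by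
        rw [hxe, algebraMap_smul, smul_smul, map_smul]
        rfl
      have h0 := hker (x - (γ m j * z) • m) (by rw [LinearMap.mem_ker, map_sub, hxe', sub_self])
      rw [Submodule.mem_bot, smul_sub, sub_eq_zero, smul_smul] at h0
      obtain ⟨q, hq⟩ := hdvd m hm j
      have : c ^ (k + 1) * y = q * (c₃ * (γ m j * z)) := by
        rw [pow_succ]
        nth_rewrite 2 [hq]
        rw [hz]
        ring
      rw [this, mul_smul, ← h0]
      exact N.smul_mem _ (N.smul_mem _ hx)
    refine ⟨k + 1, fun m hm => ?_⟩
    have hle : Submodule.span D (s : Set E) ≤ N.comap (LinearMap.lsmul D E (c ^ (k + 1) * y)) :=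
      Submodule.span_le.mpr hgen
    exact hle (hs ▸ hm)
  -- Expand `r = ∑ π_j(r) ^ p β_j`: after clearing denominators each term is a multiple of the
  -- `p`-th power of an element of `J`, and `p ≥ 2`.
  have hsq : ∀ r ∈ J, c₁ ^ p * c₂ * r ∈ J * J := fun r hr => by
    choose y hy using fun j => hπD j r
    have hsum : c₁ ^ p * c₂ * r = ∑ j, y j ^ p * β' j := by
      refine IsFractionRing.injective D (FractionRing D) ?_
      rw [map_sum, map_mul, hβ (algebraMap D (FractionRing D) r), Finset.mul_sum]
      refine Finset.sum_congr rfl fun j _ => ?_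
      have hβj : algebraMap D (FractionRing D) (β' j) = c₂ • β j := hβ' j
      rw [map_mul _ (y j ^ p), map_pow _ (y j), ← hy j, hβj, Algebra.smul_def, Algebra.smul_def,
        map_mul, map_pow]
      ring
    rw [hsum]
    refine Ideal.sum_mem _ fun j _ => Ideal.mul_mem_right _ _ ?_
    rw [← pow_two]
    exact Ideal.pow_le_pow_right hp.two_le (Ideal.pow_mem_pow (hπJ r hr j (y j) (hy j)) p)
  obtain ⟨l, k, hlk⟩ := Ideal.exists_pow_mem_of_mul_mem_sq (J := J)
    ⟨0, fun m hm => by simpa using hdN m hm⟩ hd hsq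
  obtain ⟨q, hq⟩ := pow_dvd_pow_of_dvd hγc l
  refine ⟨k + (p + 1) * l, fun m hm => ?_⟩
  rw [pow_add, pow_mul, hq, ← mul_assoc, mul_comm _ q, mul_smul]
  exact N.smul_mem _ (hlk m hm)

end CartierAction

namespace CartierAction

/-! ### The least generically nil-isomorphic submodule over a domain -/

section Domain

variable {p : ℕ} [Fact p.Prime] {D : Type u} [CommRing D] [IsDomain D] [IsNoetherianRing D]
  [CharP D p] {C : CartierAlgebra.{u, v} p D} {E : Type x} [AddCommGroup E] [Module D E]
  [Module.Finite D E] (A : CartierAction C E)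

/-- The descending chain `C₊ ^ n E` becomes stationary over `Frac D` because `E_K` is
finite-dimensional; finite generation then turns generic equality into a single multiplier. -/
theorem exists_smul_mem_plus_plus_iterate :
    ∃ (n : ℕ) (c : D), c ≠ 0 ∧ ∀ m ∈ A.plus^[n] ⊤, c • m ∈ A.plus (A.plus^[n] ⊤) := by
  have : Module.Finite (FractionRing D) (LocalizedModule (nonZeroDivisors D) E) :=
    Module.Finite.of_isLocalizedModule (nonZeroDivisors D)
      (LocalizedModule.mkLinearMap (nonZeroDivisors D) E)
  have htop : A.IsCartierSubmodule ⊤ := fun _ _ _ _ => trivial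
  obtain ⟨n, hn⟩ := IsArtinian.monotone_stabilizes (R := FractionRing D)
    (M := LocalizedModule (nonZeroDivisors D) E)
    ⟨fun n => OrderDual.toDual ((A.plus^[n] ⊤).localized (nonZeroDivisors D)),
      fun i j hij y hy => by
      obtain ⟨m, hm, s, rfl⟩ := LocalizedModule.mem_localized_iff.mp hy
      exact LocalizedModule.mk_mem_localized (htop.plus_iterate_anti hij hm) s⟩
  refine ⟨n, ?_⟩
  have hn1 : (A.plus^[n] ⊤).localized (nonZeroDivisors D) =
    (A.plus^[n + 1] ⊤).localized (nonZeroDivisors D) := hn (n + 1) (Nat.le_succ n)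
  obtain ⟨c, hc, h⟩ := (IsNoetherian.noetherian (A.plus^[n] ⊤)).exists_smul_mem
    (A.plus (A.plus^[n] ⊤)) (nonZeroDivisors D) fun x hx => by
      rw [← Function.iterate_succ_apply' A.plus]
      refine LocalizedModule.mk_mem_localized_iff (s := 1).mp ?_
      rw [← hn1]
      exact LocalizedModule.mk_mem_localized hx 1
  exact ⟨c, nonZeroDivisors.ne_zero hc, h⟩

/-- Over a domain there is a smallest Cartier submodule that generically contains `C₊ ^ n E` for
some `n`. -/
theorem exists_least_generically_nilIso (hD : (frobenius D p).Finite) :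
    ∃ T : Submodule D E, A.IsCartierSubmodule T ∧
      (∃ (n : ℕ) (c : D), c ≠ 0 ∧ ∀ m ∈ A.plus^[n] ⊤, c • m ∈ T) ∧
      ∀ N : Submodule D E, A.IsCartierSubmodule N → ∀ (n : ℕ) (c : D), c ≠ 0 →
        (∀ m ∈ A.plus^[n] ⊤, c • m ∈ N) → T ≤ N := by
  have htop : A.IsCartierSubmodule ⊤ := fun _ _ _ _ => trivial
  obtain ⟨n, c₀, hc₀, h₀⟩ := A.exists_smul_mem_plus_plus_iterate
  set Q := A.plus^[n] ⊤ with hQdef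
  have hQ : A.IsCartierSubmodule Q := htop.plus_iterate n
  obtain ⟨c₁, hc₁, h₁⟩ := A.exists_pow_smul_mem_of_generic hD hQ hc₀ h₀
  set c := c₀ * c₁ with hc
  have hcQ : ∀ m ∈ Q, c • m ∈ A.plus Q := fun m hm => by
    rw [hc, mul_comm, mul_smul]
    exact Submodule.smul_mem _ _ (h₀ m hm)
  refine ⟨A.actSpan 0 (Q.map (LinearMap.lsmul D E (c ^ 3))), A.isCartierSubmodule_actSpan 0 _,
    ⟨n, c ^ 3, pow_ne_zero 3 (mul_ne_zero hc₀ hc₁), fun m hm => A.le_actSpan_zero _ ⟨m, hm, rfl⟩⟩,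
    fun N hN k d hd hdN => (A.actSpan_mono 0 ?_).trans (hN.actSpan_le 0)⟩
  rintro _ ⟨m, hm, rfl⟩
  -- The power `c₀ ^ k` moves `Q` into `C₊ ^ k Q ⊆ C₊ ^ k E`, where `d` is known to land in `N`.
  obtain ⟨l, hl⟩ := h₁ N hN (d * c₀ ^ k) (mul_ne_zero hd (pow_ne_zero k hc₀)) fun m hm => by
    rw [mul_smul]
    refine hdN _ (htop.plus_iterate_anti (Nat.le_add_right k n) ?_)
    change _ ∈ A.plus^[k + n] ⊤
    rw [Function.iterate_add_apply]
    exact A.pow_smul_mem_plus_iterate h₀ k hm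
  refine A.pow_three_smul_mem hcQ hN (k := l) (fun m hm => ?_) hm
  rw [hc, mul_pow, mul_smul]
  exact N.smul_mem _ (hl m hm)

end Domain

end CartierAction

/-! ### Submodules of `f^! M` and their traces -/

namespace UpperShriek

variable {R : Type u} {S : Type w} {M : Type x} [CommRing R] [CommRing S] [Algebra R S]
  [AddCommGroup M] [Module R M]

theorem algebraMap_smul_apply (r : R) (μ : UpperShriek R S M) (s : S) :
    (algebraMap R S r • μ) s = r • μ s := by
  rw [smul_apply, ← Algebra.smul_def, map_smul]

instance [IsNoetherianRing R] [Module.Finite R S] [Module.Finite R M] :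
    Module.Finite S (UpperShriek R S M) := by
  have : Module.Finite R (UpperShriek R S M) := inferInstanceAs (Module.Finite R (S →ₗ[R] M))
  exact Module.Finite.of_restrictScalars_finite R S _

variable (S) in
/-- `f^! N` as a submodule of `f^! M`. -/
def submodule (N : Submodule R M) : Submodule S (UpperShriek R S M) where
  carrier := {μ | ∀ s, μ s ∈ N}
  zero_mem' _ := N.zero_mem
  add_mem' h h' s := N.add_mem (h s) (h' s)
  smul_mem' t _ h s := h (t * s)

/-- The image `Tr_M (f_* N')`. -/
def traceMap (N' : Submodule S (UpperShriek R S M)) : Submodule R M :=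
  (N'.restrictScalars R).map (trace R S M)

theorem mem_traceMap {N' : Submodule S (UpperShriek R S M)} {m : M} :
    m ∈ traceMap N' ↔ ∃ μ ∈ N', μ 1 = m := Iff.rfl

/-- Because `μ(s) = (s • μ)(1)`, controlling the values at `1` over an `S`-submodule controls all
values. -/
theorem traceMap_le_iff {N' : Submodule S (UpperShriek R S M)} {N : Submodule R M} :
    traceMap N' ≤ N ↔ N' ≤ submodule S N := by
  constructor
  · intro h μ hμ s
    exact h (mem_traceMap.mpr ⟨s • μ, N'.smul_mem s hμ, by simp⟩)
  · intro h m hm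
    obtain ⟨μ, hμ, rfl⟩ := mem_traceMap.mp hm
    exact h hμ 1

theorem torsionBySet_le_submodule (ξ : Ideal S) :
    Submodule.torsionBySet S (UpperShriek R S M) ξ ≤
      submodule S (Submodule.torsionBySet R M (ξ.comap (algebraMap R S))) := by
  intro μ hμ s
  rw [Submodule.mem_torsionBySet_iff] at hμ ⊢
  rintro ⟨a, ha⟩
  change a • μ s = 0
  rw [← algebraMap_smul_apply]
  exact DFunLike.congr_fun (hμ ⟨algebraMap R S a, ha⟩) s

end UpperShriek

namespace CartierAction

section Shriek

variable {p : ℕ} [Fact p.Prime] {R : Type u} [CommRing R] [CharP R p]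
  {C : CartierAlgebra.{u, v} p R} {M : Type x} [AddCommGroup M] [Module R M]
  (A : CartierAction C M) (S : Type w) [CommRing S] [Algebra R S]

theorem upperShriek_act_mem {N N' : Submodule R M} {e : ℕ}
    (h : ∀ κ : C.gr e, ∀ m ∈ N, A.act κ m ∈ N') (κ : (C.pullback S).gr e)
    {μ : UpperShriek R S M} (hμ : μ ∈ UpperShriek.submodule S N) :
    (A.upperShriek S).act κ μ ∈ UpperShriek.submodule S N' := by
  change A.shriekAct S (κ : S ⊗[R] C.gr e) μ ∈ UpperShriek.submodule S N'
  change S ⊗[R] C.gr e at κ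
  induction κ using TensorProduct.induction_on with
  | zero => rw [map_zero]; exact zero_mem _
  | add κ κ' h₁ h₂ => rw [map_add]; exact add_mem h₁ h₂
  | tmul a κ => exact fun s => h κ _ (hμ _)

variable {A} in
theorem IsCartierSubmodule.upperShriek {N : Submodule R M} (hN : A.IsCartierSubmodule N) :
    (A.upperShriek S).IsCartierSubmodule (UpperShriek.submodule S N) :=
  fun e κ _ hμ => A.upperShriek_act_mem S (hN e) κ hμ

theorem plus_iterate_upperShriek_le (n : ℕ) (N : Submodule R M) :
    (A.upperShriek S).plus^[n] (UpperShriek.submodule S N) ≤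
      UpperShriek.submodule S (A.plus^[n] N) := by
  induction n with
  | zero => exact le_rfl
  | succ n ih =>
    rw [Function.iterate_succ_apply', Function.iterate_succ_apply']
    refine ((A.upperShriek S).plus_mono ih).trans ((A.upperShriek S).actSpan_le
      fun e he κ μ hμ => A.upperShriek_act_mem S (fun κ m hm => A.act_mem_actSpan he κ hm) κ hμ)

variable {S}

/-- Through the lift `1 ⊗ κ`, traces of Cartier submodules are Cartier and trace is compatible with
powers of `C₊`. -/
theorem act_apply_one {e : ℕ} (κ : C.gr e) (μ : UpperShriek R S M) :
    A.act κ (μ 1) =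
      (A.upperShriek S).act (e := e) ((1 : S) ⊗ₜ[R] κ : S ⊗[R] C.gr e) μ 1 := by
  change _ = A.act κ (μ (1 * 1 ^ p ^ e))
  rw [one_pow, one_mul]

theorem isCartierSubmodule_traceMap {N' : Submodule S (UpperShriek R S M)}
    (hN' : (A.upperShriek S).IsCartierSubmodule N') :
    A.IsCartierSubmodule (UpperShriek.traceMap N') := by
  intro e κ m hm
  obtain ⟨μ, hμ, rfl⟩ := UpperShriek.mem_traceMap.mp hm
  rw [act_apply_one]
  exact UpperShriek.mem_traceMap.mpr ⟨_, hN' e _ μ hμ, rfl⟩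

theorem plus_iterate_traceMap_le (n : ℕ) (N' : Submodule S (UpperShriek R S M)) :
    A.plus^[n] (UpperShriek.traceMap N') ≤
      UpperShriek.traceMap ((A.upperShriek S).plus^[n] N') := by
  induction n with
  | zero => exact le_rfl
  | succ n ih =>
    rw [Function.iterate_succ_apply', Function.iterate_succ_apply']
    refine (A.plus_mono ih).trans (A.actSpan_le fun e he κ m hm => ?_)
    obtain ⟨μ, hμ, rfl⟩ := UpperShriek.mem_traceMap.mp hm
    rw [act_apply_one]
    exact UpperShriek.mem_traceMap.mpr ⟨_, (A.upperShriek S).act_mem_actSpan he _ hμ, rfl⟩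

end Shriek

end CartierAction

/-! ### Torsion and associated primes along a finite map -/

/-- A finite extension of domains has a linear functional that does not vanish at `1`. -/
theorem exists_linearMap_apply_one_ne_zero (D B : Type*) [CommRing D] [IsDomain D] [CommRing B]
    [IsDomain B] [Algebra D B] [FaithfulSMul D B] [Module.Finite D B] :
    ∃ l : B →ₗ[D] D, l 1 ≠ 0 := by
  let : Algebra (FractionRing D) (FractionRing B) := FractionRing.liftAlgebra D (FractionRing B)
  have : IsScalarTower D (FractionRing D) (FractionRing B) :=
    FractionRing.isScalarTower_liftAlgebra D (FractionRing B)
  -- A linear retraction of `Frac B` onto `Frac D`; since `B` is finite, one multiple of it maps `B`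
  -- into `D`.
  obtain ⟨f, hf⟩ := LinearMap.exists_leftInverse_of_injective
    (LinearMap.toSpanSingleton (FractionRing D) (FractionRing B) 1)
    (LinearMap.ker_toSpanSingleton _ one_ne_zero)
  have hf1 : f 1 = 1 := by simpa using LinearMap.congr_fun hf 1
  let g : B →ₗ[D] FractionRing D :=
    (f.restrictScalars D).comp (IsScalarTower.toAlgHom D B (FractionRing B)).toLinearMap
  have hg1 : g 1 = 1 := by simp [g, hf1]
  have hfg : (LinearMap.range g).FG := Module.Finite.iff_fg.mp (Module.Finite.range g)
  obtain ⟨c, hc, h⟩ := hfg.exists_smul_mem (LinearMap.range (Algebra.linearMap D (FractionRing D)))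
    (nonZeroDivisors D) fun x _ => by
      obtain ⟨⟨a, s⟩, has⟩ := IsLocalization.surj (nonZeroDivisors D) x
      exact ⟨s, s.2, a, by rw [Algebra.smul_def, mul_comm, has]; rfl⟩
  let e := LinearEquiv.ofInjective (Algebra.linearMap D (FractionRing D))
    (IsFractionRing.injective D (FractionRing D))
  refine ⟨e.symm.toLinearMap.comp ((c • g).codRestrict _ fun s => h _ ⟨s, rfl⟩), fun h0 => ?_⟩
  have h1 := congrArg Subtype.val (e.symm.map_eq_zero_iff.mp h0)
  change c • g 1 = 0 at h1
  rw [hg1, Algebra.smul_def, mul_one] at h1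
  exact nonZeroDivisors.ne_zero hc
    ((map_eq_zero_iff _ (IsFractionRing.injective D (FractionRing D))).mp h1)

section Quotient

variable {R : Type u} [CommRing R] {S : Type w} [CommRing S] [Algebra R S] [Module.Finite R S]
  (η : Ideal R) (ξ : Ideal S) [η.IsPrime] [ξ.IsPrime] [ξ.LiesOver η]

theorem finite_quotient_of_liesOver : Module.Finite (R ⧸ η) (S ⧸ ξ) :=
  Module.Finite.of_restrictScalars_finite R (R ⧸ η) (S ⧸ ξ)

/-- A nonzero element of `S/ξ`, being integral over the domain `R/η`, divides a nonzero element of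
`R/η`. This replaces denominators from `S` by denominators from `R`. -/
theorem exists_mul_sub_algebraMap_mem {t : S} (ht : t ∉ ξ) :
    ∃ (s : S) (r : R), r ∉ η ∧ t * s - algebraMap R S r ∈ ξ := by
  have := finite_quotient_of_liesOver η ξ
  have ht' : Ideal.Quotient.mk ξ t ≠ 0 := fun h => ht (Ideal.Quotient.eq_zero_iff_mem.mp h)
  have halg : IsAlgebraic (R ⧸ η) (Ideal.Quotient.mk ξ t) :=
    (Algebra.IsIntegral.isIntegral (R := R ⧸ η) (Ideal.Quotient.mk ξ t)).isAlgebraic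
  obtain ⟨r', hr', s', hs'⟩ := halg.exists_nonzero_dvd (mem_nonZeroDivisors_of_ne_zero ht')
  obtain ⟨r, rfl⟩ := Ideal.Quotient.mk_surjective r'
  obtain ⟨s, rfl⟩ := Ideal.Quotient.mk_surjective s'
  refine ⟨s, r, fun h => hr' (Ideal.Quotient.eq_zero_iff_mem.mpr h), ?_⟩
  rw [← Ideal.Quotient.eq_zero_iff_mem, map_sub, map_mul, ← hs', sub_eq_zero]
  rfl

variable {M : Type x} [AddCommGroup M] [Module R M]

/-- The element of `Hom_R(R/η, M)` with value `m` at `1`, for `m` annihilated by `η`. -/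
def UpperShriek.ofTorsion (η : Ideal R) (m : M) (hm : m ∈ Submodule.torsionBySet R M η) :
    UpperShriek R (R ⧸ η) M :=
  Submodule.liftQ η (LinearMap.toSpanSingleton R M m) fun a ha =>
    (Submodule.mem_torsionBySet_iff _ _).mp hm ⟨a, ha⟩

theorem UpperShriek.ofTorsion_mk (η : Ideal R) (m : M) (hm : m ∈ Submodule.torsionBySet R M η)
    (r : R) : UpperShriek.ofTorsion η m hm (Ideal.Quotient.mk η r) = r • m := rfl

/-- Compose `S → S/ξ`, a functional `S/ξ → R/η` nonzero at `1`, and the map `R/η → M` given by `m`.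
The multiplier `c` lifts the value of the functional at `1`, so it is independent of `m`. -/
theorem UpperShriek.exists_torsionBySet_apply_one : ∃ c ∉ η,
    ∀ m ∈ Submodule.torsionBySet R M η,
      ∃ μ ∈ Submodule.torsionBySet S (UpperShriek R S M) ξ, μ 1 = c • m := by
  have := finite_quotient_of_liesOver η ξ
  obtain ⟨l, hl⟩ := exists_linearMap_apply_one_ne_zero (R ⧸ η) (S ⧸ ξ)
  obtain ⟨c, hc⟩ := Ideal.Quotient.mk_surjective (l 1)
  refine ⟨c, fun h => hl (hc ▸ Ideal.Quotient.eq_zero_iff_mem.mpr h), fun m hm => ?_⟩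
  let μ : UpperShriek R S M := LinearMap.comp (UpperShriek.ofTorsion η m hm : (R ⧸ η) →ₗ[R] M)
    ((l.restrictScalars R).comp (Ideal.Quotient.mkₐ R ξ).toLinearMap)
  have hμ : ∀ s, μ s = UpperShriek.ofTorsion η m hm (l (Ideal.Quotient.mk ξ s)) := fun s => rfl
  refine ⟨μ, (Submodule.mem_torsionBySet_iff _ _).mpr ?_, ?_⟩
  · rintro ⟨t, ht⟩
    refine UpperShriek.ext fun s => ?_
    change μ (t * s) = 0
    rw [hμ, map_mul, Ideal.Quotient.eq_zero_iff_mem.mpr ht, zero_mul, map_zero, map_zero]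
  · rw [hμ, map_one, ← hc, UpperShriek.ofTorsion_mk]

/-- If `m` has annihilator `η`, the `μ` built from it has annihilator exactly `ξ`: a `t ∉ ξ` killing
`μ` would yield `r ∉ η` with `r c m = 0`. -/
theorem UpperShriek.mem_associatedPrimes_of_liesOver [IsNoetherianRing R]
    (h : η ∈ associatedPrimes R M) : ξ ∈ associatedPrimes S (UpperShriek R S M) := by
  have : IsNoetherianRing S := IsNoetherianRing.of_finite R S
  obtain ⟨-, m, hm⟩ := isAssociatedPrime_iff.mp h
  have hann : ∀ r, r ∈ η ↔ r • m = 0 := fun r => by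
    rw [hm, Submodule.mem_colon_singleton, Submodule.mem_bot]
  obtain ⟨c, hc, hcm⟩ := UpperShriek.exists_torsionBySet_apply_one (M := M) η ξ
  obtain ⟨μ, hμ, hμ1⟩ := hcm m ((Submodule.mem_torsionBySet_iff _ _).mpr
    fun a => (hann a).mp a.2)
  rw [Submodule.mem_torsionBySet_iff] at hμ
  refine isAssociatedPrime_iff.mpr ⟨inferInstance, μ, ?_⟩
  ext t
  rw [Submodule.mem_colon_singleton, Submodule.mem_bot]
  refine ⟨fun ht => hμ ⟨t, ht⟩, fun ht => ?_⟩
  by_contra htξ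
  obtain ⟨s, r, hr, hsr⟩ := exists_mul_sub_algebraMap_mem η ξ htξ
  have h0 : algebraMap R S r • μ = 0 := by
    have h1 : (t * s - algebraMap R S r) • μ = 0 := hμ ⟨_, hsr⟩
    rw [sub_smul, mul_comm, mul_smul, ht, smul_zero, zero_sub, neg_eq_zero] at h1
    exact h1
  have h1 := DFunLike.congr_fun h0 1
  rw [UpperShriek.algebraMap_smul_apply, hμ1, smul_smul] at h1
  exact (‹η.IsPrime›.mem_or_mem ((hann _).mpr h1)).elim hr hc

end Quotient

/-- Let `μ` have annihilator `ξ`. If each value of `μ` were killed by an element outside `η`,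
finiteness of the image would give one such element killing `μ`. So some value has annihilator
exactly `η`. -/
theorem UpperShriek.comap_mem_associatedPrimes {R : Type u} [CommRing R] [IsNoetherianRing R]
    {S : Type w} [CommRing S] [Algebra R S] [Module.Finite R S] {M : Type x} [AddCommGroup M]
    [Module R M] {ξ : Ideal S} (h : ξ ∈ associatedPrimes S (UpperShriek R S M)) :
    ξ.comap (algebraMap R S) ∈ associatedPrimes R M := by
  have : IsNoetherianRing S := IsNoetherianRing.of_finite R S
  obtain ⟨hξ, μ, hμ⟩ := isAssociatedPrime_iff.mp h
  set η := ξ.comap (algebraMap R S) with hη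
  have hprime : η.IsPrime := Ideal.comap_isPrime _ _
  have hann : ∀ r, r ∈ η ↔ algebraMap R S r • μ = 0 := fun r => by
    rw [hη, Ideal.mem_comap, hμ, Submodule.mem_colon_singleton, Submodule.mem_bot]
  have hfg : (LinearMap.range (μ : S →ₗ[R] M)).FG := Module.Finite.iff_fg.mp (Module.Finite.range _)
  obtain ⟨m, ⟨s, rfl⟩, hm⟩ : ∃ m ∈ LinearMap.range (μ : S →ₗ[R] M), ∀ c ∈ η.primeCompl,
      c • m ∉ (⊥ : Submodule R M) := by
    by_contra! hcon
    obtain ⟨c, hc, hcμ⟩ := hfg.exists_smul_mem ⊥ η.primeCompl hcon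
    refine hc ((hann c).mpr (UpperShriek.ext fun s => ?_))
    rw [UpperShriek.algebraMap_smul_apply]
    exact hcμ _ ⟨s, rfl⟩
  refine isAssociatedPrime_iff.mpr ⟨hprime, μ s, ?_⟩
  ext r
  rw [Submodule.mem_colon_singleton]
  refine ⟨fun hr => ?_, fun hr => by_contra fun hrη => hm r hrη hr⟩
  rw [Submodule.mem_bot, ← UpperShriek.algebraMap_smul_apply, (hann r).mp hr]
  rfl

namespace CartierAction

/-! ### Existence of test modules and their behavior under `f^!` and trace -/

section Existence

variable {p : ℕ} [Fact p.Prime] {R : Type u} [CommRing R] [CharP R p] [IsNoetherianRing R]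
  {C : CartierAlgebra.{u, v} p R} {M : Type x} [AddCommGroup M] [Module R M] [Module.Finite R M]
  (A : CartierAction C M)

/-- Apply the domain case to `Hom_R(R/η, M)`, which evaluation at `1` identifies with `M[η]`. The
Galois connection between trace and `f^!` carries the least element back to `M`. -/
theorem exists_least_isNilAt (hR : (frobenius R p).Finite) (η : Ideal R) [η.IsPrime] :
    ∃ T : Submodule R M, A.IsCartierSubmodule T ∧ A.IsNilAt η T ∧
      ∀ N : Submodule R M, A.IsCartierSubmodule N → A.IsNilAt η N → T ≤ N := by
  have : CharP (R ⧸ η) p := (CharP.charP_iff_prime_eq_zero Fact.out).mpr (by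
    rw [← map_natCast (Ideal.Quotient.mk η), CharP.cast_eq_zero, map_zero])
  have hE : Submodule.torsionBySet R M η ≤
      UpperShriek.traceMap (⊤ : Submodule (R ⧸ η) (UpperShriek R (R ⧸ η) M)) := fun m hm =>
    UpperShriek.mem_traceMap.mpr ⟨UpperShriek.ofTorsion η m hm, trivial, one_smul R m⟩
  have hE' : (⊤ : Submodule (R ⧸ η) (UpperShriek R (R ⧸ η) M)) ≤
      UpperShriek.submodule (R ⧸ η) (Submodule.torsionBySet R M η) := fun μ _ s => by
    rw [Submodule.mem_torsionBySet_iff]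
    rintro ⟨a, ha⟩
    change a • μ s = 0
    rw [← UpperShriek.algebraMap_smul_apply]
    change (Ideal.Quotient.mk η a • μ) s = 0
    rw [Ideal.Quotient.eq_zero_iff_mem.mpr ha, zero_smul]
    rfl
  obtain ⟨T, hT, ⟨n, c', hc', hn⟩, hleast⟩ :=
    (A.upperShriek (R ⧸ η)).exists_least_generically_nilIso (frobenius_finite_of_finite hR)
  refine ⟨UpperShriek.traceMap T, A.isCartierSubmodule_traceMap hT, ?_, fun N hN hnil => ?_⟩
  · obtain ⟨c, rfl⟩ := Ideal.Quotient.mk_surjective c'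
    refine ⟨n, c, fun h => hc' (Ideal.Quotient.eq_zero_iff_mem.mpr h), fun m hm => ?_⟩
    obtain ⟨μ, hμ, rfl⟩ := UpperShriek.mem_traceMap.mp
      (A.plus_iterate_traceMap_le n _ (A.plus_mono.iterate n hE hm))
    exact UpperShriek.mem_traceMap.mpr ⟨_, hn μ hμ, UpperShriek.algebraMap_smul_apply c μ 1⟩
  · obtain ⟨n, c, hc, hn⟩ := hnil
    refine UpperShriek.traceMap_le_iff.mpr (hleast _ (hN.upperShriek _) n (Ideal.Quotient.mk η c)
      (fun h => hc (Ideal.Quotient.eq_zero_iff_mem.mp h)) fun μ hμ s => ?_)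
    have h1 := A.plus_iterate_upperShriek_le (R ⧸ η) n _
      ((A.upperShriek (R ⧸ η)).plus_mono.iterate n hE' hμ) s
    have h2 := UpperShriek.algebraMap_smul_apply c μ s
    exact h2 ▸ hn _ h1

/-- The conditions at different primes are independent and pass to larger submodules, so the sum of
the least solutions is the least common solution. -/
theorem isTestModule_testModule (hR : (frobenius R p).Finite) :
    A.IsTestModule A.testModule := by
  have hex : ∀ η : associatedPrimes R M, ∃ T : Submodule R M, A.IsCartierSubmodule T ∧
      A.IsNilAt η.1 T ∧ ∀ N : Submodule R M, A.IsCartierSubmodule N → A.IsNilAt η.1 N → T ≤ N :=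
    fun η => A.exists_least_isNilAt hR η.1
  choose T hT hnil hleast using hex
  have h : IsLeast A.testFamily (⨆ η, T η) := by
    refine ⟨A.mem_testFamily_iff.mpr ⟨IsCartierSubmodule.iSup hT, fun η hη =>
      (hnil ⟨η, hη⟩).mono (le_iSup T ⟨η, hη⟩)⟩, fun N hN => iSup_le fun η => ?_⟩
    obtain ⟨hN, hN'⟩ := A.mem_testFamily_iff.mp hN
    exact hleast η N hN (hN' η.1 η.2)
  have heq : A.testModule = ⨆ η, T η := h.isGLB.sInf_eq
  rw [IsTestModule, heq]
  exact h

variable {S : Type w} [CommRing S] [CharP S p] [Algebra R S] [Module.Finite R S]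

theorem submodule_mem_testFamily {N : Submodule R M} (hN : N ∈ A.testFamily) :
    UpperShriek.submodule S N ∈ (A.upperShriek S).testFamily := by
  have : IsNoetherianRing S := IsNoetherianRing.of_finite R S
  obtain ⟨hN, hnil⟩ := A.mem_testFamily_iff.mp hN
  refine (A.upperShriek S).mem_testFamily_iff.mpr ⟨hN.upperShriek S, fun ξ hξ => ?_⟩
  obtain ⟨n, c, hc, h⟩ := hnil _ (UpperShriek.comap_mem_associatedPrimes hξ)
  refine ⟨n, algebraMap R S c, hc, fun μ hμ s => ?_⟩
  rw [UpperShriek.algebraMap_smul_apply]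
  exact h _ (A.plus_iterate_upperShriek_le S n _
    ((A.upperShriek S).plus_mono.iterate n (UpperShriek.torsionBySet_le_submodule ξ) hμ) s)

/-- Choose `ξ` over `η`. Up to a multiplier outside `η`, torsion at `η` consists of traces of
torsion at `ξ`, so the condition for `N'` at `ξ` descends to `η`. -/
theorem traceMap_mem_testFamily
    (hsurj : Function.Surjective (PrimeSpectrum.comap (algebraMap R S)))
    {N' : Submodule S (UpperShriek R S M)} (hN' : N' ∈ (A.upperShriek S).testFamily) :
    UpperShriek.traceMap N' ∈ A.testFamily := by
  have : IsNoetherianRing S := IsNoetherianRing.of_finite R S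
  obtain ⟨hN', hnil⟩ := (A.upperShriek S).mem_testFamily_iff.mp hN'
  refine A.mem_testFamily_iff.mpr ⟨A.isCartierSubmodule_traceMap hN', fun η hη => ?_⟩
  have hprime : η.IsPrime := hη.isPrime
  obtain ⟨⟨ξ, hξ⟩, hξη⟩ := hsurj ⟨η, hprime⟩
  have : ξ.LiesOver η := ⟨(congrArg PrimeSpectrum.asIdeal hξη).symm⟩
  obtain ⟨n, t, ht, hn⟩ := hnil ξ (UpperShriek.mem_associatedPrimes_of_liesOver η ξ hη)
  obtain ⟨s, r, hr, hsr⟩ := exists_mul_sub_algebraMap_mem η ξ ht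
  obtain ⟨c, hc, hcm⟩ := UpperShriek.exists_torsionBySet_apply_one (M := M) η ξ
  refine ⟨n, r * c, fun h => (hprime.mem_or_mem h).elim hr hc, fun m hm => ?_⟩
  have h1 : c • m ∈ A.plus^[n]
      (UpperShriek.traceMap (Submodule.torsionBySet S (UpperShriek R S M) ξ)) :=
    A.smul_mem_plus_iterate n (fun m hm => UpperShriek.mem_traceMap.mpr (hcm m hm)) hm
  obtain ⟨μ, hμ, hμ1⟩ := UpperShriek.mem_traceMap.mp (A.plus_iterate_traceMap_le n _ h1)
  -- As `μ` is `ξ`-torsion, `s t μ = r μ`; thus `r μ ∈ N'`, and its trace is `r c m`.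
  have h2 : (t * s - algebraMap R S r) • μ = 0 := (Submodule.mem_torsionBySet_iff _ _).mp
    ((A.upperShriek S).plus_iterate_torsionBySet_le n ξ hμ) ⟨_, hsr⟩
  rw [sub_smul, sub_eq_zero, mul_comm, mul_smul] at h2
  rw [mul_smul, ← hμ1]
  exact UpperShriek.mem_traceMap.mpr ⟨s • t • μ, N'.smul_mem s (hn μ hμ), by
    rw [h2, UpperShriek.algebraMap_smul_apply]⟩

end Existence

end CartierAction

/-! ### Dominance and the main theorem -/

theorem surjective_comap_of_denseRange {R S : Type*} [CommRing R] [CommRing S] [Algebra R S]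
    [Module.Finite R S] (hdom : DenseRange (PrimeSpectrum.comap (algebraMap R S))) :
    Function.Surjective (PrimeSpectrum.comap (algebraMap R S)) := by
  have hclosed := (PrimeSpectrum.isClosedMap_comap_of_isIntegral (algebraMap R S)
    (algebraMap_isIntegral_iff.mpr inferInstance)).isClosed_range
  rw [← Set.range_eq_univ, ← hclosed.closure_eq, hdom.closure_eq]

theorem mainTheorem1 {p : ℕ} [Fact p.Prime]
    {R : Type u} [CommRing R] [CharP R p] [IsNoetherianRing R]
    (hR : (frobenius R p).Finite)
    {S : Type w} [CommRing S] [CharP S p] [Algebra R S] [Module.Finite R S]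
    (hdom : DenseRange (PrimeSpectrum.comap (algebraMap R S)))
    (C : CartierAlgebra.{u, v} p R)
    {M : Type x} [AddCommGroup M] [Module R M] [Module.Finite R M]
    (A : CartierAction C M) :
    A.IsTestModule A.testModule ∧
    (A.upperShriek S).IsTestModule (A.upperShriek S).testModule ∧
    ((A.upperShriek S).testModule.restrictScalars R).map (UpperShriek.trace R S M) =
      A.testModule ∧
    (A.IsFRegular → Function.Surjective (UpperShriek.trace R S M)) ∧
    (Function.Surjective (UpperShriek.trace R S M) → (A.upperShriek S).IsFRegular →
      A.IsFRegular) := by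
  have : IsNoetherianRing S := IsNoetherianRing.of_finite R S
  have h₁ := A.isTestModule_testModule hR
  have h₂ := (A.upperShriek S).isTestModule_testModule (frobenius_finite_of_finite hR)
  -- Minimality upstairs against `f^! τ(M)` gives one inclusion, minimality downstairs against the
  -- trace of `τ(f^! M)` the other.
  have h₃ : UpperShriek.traceMap (A.upperShriek S).testModule = A.testModule := le_antisymm
    (UpperShriek.traceMap_le_iff.mpr (h₂.2 (A.submodule_mem_testFamily h₁.1)))
    (h₁.2 (A.traceMap_mem_testFamily (surjective_comap_of_denseRange hdom) h₂.1))
  refine ⟨h₁, h₂, h₃, fun hreg m => ?_, fun hsurj hreg => ?_⟩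
  · have hm : m ∈ UpperShriek.traceMap (A.upperShriek S).testModule := by
      rw [h₃, hreg]
      trivial
    obtain ⟨μ, -, hμ⟩ := hm
    exact ⟨μ, hμ⟩
  · rw [CartierAction.IsFRegular, ← h₃, hreg, eq_top_iff]
    intro m _
    obtain ⟨μ, hμ⟩ := hsurj m
    exact ⟨μ, trivial, hμ⟩
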